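/- Let $\lambda\in\mathbb C$, let $m>0$ and $\mu$ be real, and let $j$ be an integer. Let $w$ be a radial vortex profile, i.e. a non-negative $C^2$ function on $(0,\infty)$ with $$-w''-\tfrac1r w'+\tfrac{m^2}{r^2}w+r^2w+2|w|^2w-2\mu w=0\quad(r>0),$$ which is bounded as $r\to0^+$ and tends to $0$ as $r\to\infty$. Put $$B_\infty=\begin{pmatrix}0&1&0&0\\k^+&-\frac1r&0&0\\0&0&0&1\\0&0&k^-&-\frac1r\end{pmatrix},\quad B_0=\begin{pmatrix}0&1&0&0\\l^+&-\frac1r&0&0\\0&0&0&1\\0&0&l^-&-\frac1r\end{pmatrix},\quad B_w=|w|^2\begin{pmatrix}0&0&0&0\\4&0&2&0\\0&0&0&0\\2&0&4&0\end{pmatrix},$$ where $k^\pm(r)=\frac{(j\pm m)^2}{r^2}+r^2-2\mu\mp2i\lambda$, $l^\pm(r)=\frac{(j\pm m)^2}{r^2}$, and $B=B_\infty+B_w$. For functions $f,g$ of $r$ with values in $\mathbb C^4$ write $f\sim g$ if $|f-g|=o(|g|)$ and also $|(f_1,f_3)-(g_1,g_3)|=o(|(g_1,g_3)|)$. Then there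 are solutions $y_i^{(0)}$ and $y_i^{(\infty)}$, $i=1,2,3,4$, on $(0,\infty)$ of the radial eigenvalue system $y'=By$, linearly independent solutions $y_{01},\dots,y_{04}$ on $(0,\infty)$ of $y'=B_0y$, and linearly independent solutions $y_{\infty1},\dots,y_{\infty4}$ on $(0,\infty)$ of $y'=B_\infty y$ such that, for each $i$, $$y_i^{(0)}\sim y_{0i}\ \text{ as } r\to0^+,\qquad y_i^{(\infty)}\sim y_{\infty i}\ \text{ as } r\to\infty .$$ Moreover, with $\alpha_\pm=\mu\pm i\lambda$, as $r\to\infty$ $$\begin{array}{ll}y_{\infty1}\sim e^{r^2/2}r^{-\alpha_+}(1/r,1,0,0)^T,& y_{\infty2}\sim e^{r^2/2}r^{-\alpha_-}(0,0,1/r,1)^T,\\ y_{\infty3}\sim e^{-r^2/2}r^{\alpha_+}(1/r,-1,0,0)^T,& y_{\infty4}\sim e^{-r^2/2}r^{\alpha_-}(0,0,1/r,-1)^T,\end{array}$$ and as $r\to0^+$ $$\begin{array}{ll}y_{01}\sim r^{|j+m|}(1,|j+m|/r,0,0)^T,& y_{02}\sim r^{|j-m|}(0,0,1,|j-m|/r)^T,\\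 y_{03}\sim r^{-|j+m|}(1,-|j+m|/r,0,0)^T,& y_{04}\sim r^{-|j-m|}(0,0,1,-|j-m|/r)^T,\end{array}$$ except that $y_{03}\sim(\log r,1/r,0,0)^T$ if $j+m=0$, and $y_{04}\sim(0,0,\log r,1/r)^T$ if $j-m=0$. -/

import Mathlib

open Set Filter Topology Asymptotics Matrix

noncomputable section

/-- A radial vortex profile with winding number `m` and chemical potential `μ`: a non-negative,
twice continuously differentiable function on `(0, ∞)` which solves
`-w'' - w'/r + (m²/r²) w + r² w + 2 |w|² w - 2 μ w = 0`, is bounded as `r → 0⁺` and tends to `0`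
as `r → ∞`. -/
structure IsVortexProfile (m μ : ℝ) (w : ℝ → ℝ) : Prop where
  contDiffOn : ContDiffOn ℝ 2 w (Ioi 0)
  equation : ∀ r : ℝ, 0 < r →
    -deriv (deriv w) r - 1 / r * deriv w r + m ^ 2 / r ^ 2 * w r + r ^ 2 * w r
      + 2 * |w r| ^ 2 * w r - 2 * μ * w r = 0
  nonneg : ∀ r : ℝ, 0 < r → 0 ≤ w r
  bounded_zero : ∃ C : ℝ, ∀ᶠ r in 𝓝[>] (0 : ℝ), |w r| ≤ C
  tendsto_zero : Tendsto w atTop (𝓝 0)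

/-- `k⁺(r, λ) = (j+m)²/r² + r² - 2μ - 2iλ`. -/
def kPlus (j : ℤ) (m μ : ℝ) (lam : ℂ) (r : ℝ) : ℂ :=
  (((j : ℝ) + m) ^ 2 / r ^ 2 + r ^ 2 - 2 * μ : ℝ) - 2 * Complex.I * lam

/-- `k⁻(r, λ) = (j-m)²/r² + r² - 2μ + 2iλ`. -/
def kMinus (j : ℤ) (m μ : ℝ) (lam : ℂ) (r : ℝ) : ℂ :=
  (((j : ℝ) - m) ^ 2 / r ^ 2 + r ^ 2 - 2 * μ : ℝ) + 2 * Complex.I * lam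

/-- `l⁺(r) = (j+m)²/r²`. -/
def lPlus (j : ℤ) (m : ℝ) (r : ℝ) : ℂ := (((j : ℝ) + m) ^ 2 / r ^ 2 : ℝ)

/-- `l⁻(r) = (j-m)²/r²`. -/
def lMinus (j : ℤ) (m : ℝ) (r : ℝ) : ℂ := (((j : ℝ) - m) ^ 2 / r ^ 2 : ℝ)

/-- The coefficient matrix of the model system at infinity. -/
def matBInf (j : ℤ) (m μ : ℝ) (lam : ℂ) (r : ℝ) : Matrix (Fin 4) (Fin 4) ℂ :=
  !![0, 1, 0, 0;
     kPlus j m μ lam r, -1 / (r : ℂ), 0, 0;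
     0, 0, 0, 1;
     0, 0, kMinus j m μ lam r, -1 / (r : ℂ)]

/-- The coefficient matrix of the model system at zero. -/
def matBZero (j : ℤ) (m : ℝ) (r : ℝ) : Matrix (Fin 4) (Fin 4) ℂ :=
  !![0, 1, 0, 0;
     lPlus j m r, -1 / (r : ℂ), 0, 0;
     0, 0, 0, 1;
     0, 0, lMinus j m r, -1 / (r : ℂ)]

/-- The part of the coefficient matrix that comes from the vortex profile. -/
def matBW (w : ℝ → ℝ) (r : ℝ) : Matrix (Fin 4) (Fin 4) ℂ :=
  ((|w r| ^ 2 : ℝ) : ℂ) •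
    !![0, 0, 0, 0;
       4, 0, 2, 0;
       0, 0, 0, 0;
       2, 0, 4, 0]

/-- The coefficient matrix `B = B_∞ + B_w` of the radial eigenvalue system. -/
def matB (w : ℝ → ℝ) (j : ℤ) (m μ : ℝ) (lam : ℂ) (r : ℝ) : Matrix (Fin 4) (Fin 4) ℂ :=
  matBInf j m μ lam r + matBW w r

/-- `y` solves the linear system `y' = M(r) y` on `(0, ∞)`. -/
def IsSolutionOfSystem (M : ℝ → Matrix (Fin 4) (Fin 4) ℂ) (y : ℝ → Fin 4 → ℂ) : Prop :=
  ∀ r : ℝ, 0 < r → HasDerivAt y (M r *ᵥ y r) r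

/-- The values `(y₊, y₋)` in a vector `(y₊, y₊', y₋, y₋')`. -/
def valuePart (v : Fin 4 → ℂ) : Fin 2 → ℂ := ![v 0, v 2]

/-- Asymptotic equivalence `f ∼ g` of vector functions `(y₊, y₊', y₋, y₋')`: the relative error
tends to zero for the whole vector, and also for the pair of values `(y₊, y₋)` by itself.
(The values and the derivatives have different orders of magnitude at both ends of `(0, ∞)`, so
that the first condition alone would not determine the leading term of the values near zero.) -/
def AsympEquiv (l : Filter ℝ) (f g : ℝ → Fin 4 → ℂ) : Prop :=
  (fun r => f r - g r) =o[l] g ∧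
    (fun r => valuePart (f r) - valuePart (g r)) =o[l] fun r => valuePart (g r)

/-- Leading terms as `r → 0⁺`. If `j + m = 0` (resp. `j - m = 0`), then the exponents `±|j + m|`
(resp. `±|j - m|`) coincide, and the second one belongs to the solution `log r`. -/
def leadZero (j : ℤ) (m : ℝ) : Fin 4 → ℝ → Fin 4 → ℂ :=
  ![fun r => ((r ^ |(j : ℝ) + m| : ℝ) : ℂ) • ![1, ((|(j : ℝ) + m| / r : ℝ) : ℂ), 0, 0],
    fun r => ((r ^ |(j : ℝ) - m| : ℝ) : ℂ) • ![0, 0, 1, ((|(j : ℝ) - m| / r : ℝ) : ℂ)],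
    fun r => if (j : ℝ) + m = 0 then ![((Real.log r : ℝ) : ℂ), ((1 / r : ℝ) : ℂ), 0, 0]
      else ((r ^ (-|(j : ℝ) + m|) : ℝ) : ℂ) • ![1, ((-|(j : ℝ) + m| / r : ℝ) : ℂ), 0, 0],
    fun r => if (j : ℝ) - m = 0 then ![0, 0, ((Real.log r : ℝ) : ℂ), ((1 / r : ℝ) : ℂ)]
      else ((r ^ (-|(j : ℝ) - m|) : ℝ) : ℂ) • ![0, 0, 1, ((-|(j : ℝ) - m| / r : ℝ) : ℂ)]]

/-- `α₊ = μ + iλ`. -/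
def alphaPlus (μ : ℝ) (lam : ℂ) : ℂ := μ + Complex.I * lam

/-- `α₋ = μ - iλ`. -/
def alphaMinus (μ : ℝ) (lam : ℂ) : ℂ := μ - Complex.I * lam

/-- Leading terms as `r → ∞`. -/
def leadInf (μ : ℝ) (lam : ℂ) : Fin 4 → ℝ → Fin 4 → ℂ :=
  ![fun r => (((Real.exp (r ^ 2 / 2) : ℝ) : ℂ) * (r : ℂ) ^ (-alphaPlus μ lam)) •
      ![1 / (r : ℂ), 1, 0, 0],
    fun r => (((Real.exp (r ^ 2 / 2) : ℝ) : ℂ) * (r : ℂ) ^ (-alphaMinus μ lam)) •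
      ![0, 0, 1 / (r : ℂ), 1],
    fun r => (((Real.exp (-r ^ 2 / 2) : ℝ) : ℂ) * (r : ℂ) ^ alphaPlus μ lam) •
      ![1 / (r : ℂ), -1, 0, 0],
    fun r => (((Real.exp (-r ^ 2 / 2) : ℝ) : ℂ) * (r : ℂ) ^ alphaMinus μ lam) •
      ![0, 0, 1 / (r : ℂ), -1]]

end

/-! Near each end the system is a perturbation of two decoupled second-order equations, and the
perturbation is integrable relative to suitable modes. Let the mode `k` have value `u k` and slope
`p k`, with `u'' + u'/r = D u`. Writing `y` as a combination of the modes with variable coefficients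
`c k` turns `y' = B y` into `c' = Q c`, where `Q k l` is the residual of the modes, times `u (k + 2)
* u l`, divided by the Wronskian of the block (`hasDerivAt_combineModes`).

Levinson's argument handles `c' = Q c`. In the scaled unknowns `x k = c k * g k / g i`, where `g k`
measures the size of the mode `k`, the coefficients are bounded by an integrable `ρ`. Each quotient
`g k / g i` is monotone, so integrating from the finite end when it decays, and from infinity
otherwise, gives an integral equation that is a contraction far enough out. Its solution tends to
the `i`-th unit vector (`exists_asymptotic_atTop`). Linear existence and uniqueness extend the
resulting local solution to `(0, ∞)`.

At zero the modes `r^(±|j ± m|)` (or `1, log r`) solve the model system exactly. The residual is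
bounded because `w` is, and the Wronskian is a constant over `r`. The substitution `t = 1/r` reduces
this end to infinity.

At infinity the modes are `exp (±r²/2) * r^β`, with `β` chosen so that `r² - 2α` is reproduced
exactly and only `O(1/r²)` remains. The Wronskian grows like `r` times the product of the modes, so
the residual must be better than `o(1)`: a maximum principle gives `w = O(1/r)`, hence `w² = O(1/r)`
and `ρ = O(1/r²)`. The model system at infinity is the case `w = 0` of the same result. -/

open MeasureTheory

/-! ### Linear differential equations: global existence and extension -/

/-- A map of bounded continuous functions that is a contraction with constant `1/2`, given by its
values at points, has a fixed point. -/
theorem exists_fixed_boundedContinuousFunction {E : Type*} [NormedAddCommGroup E] [CompleteSpace E]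
    (F : BoundedContinuousFunction ℝ E → ℝ → E) (hc : ∀ u, Continuous (F u))
    (hb : ∃ C, ∀ t, ‖F 0 t‖ ≤ C)
    (hl : ∀ u v t, ‖F u t - F v t‖ ≤ 1 / 2 * ‖u - v‖) :
    ∃ u : BoundedContinuousFunction ℝ E, ∀ t, u t = F u t := by
  obtain ⟨C, hC⟩ := hb
  let G : BoundedContinuousFunction ℝ E → BoundedContinuousFunction ℝ E := fun u =>
    BoundedContinuousFunction.ofNormedAddCommGroup (F u) (hc u) (1 / 2 * ‖u‖ + C) (fun t => by
      have h1 := hl u 0 t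
      rw [sub_zero] at h1
      have h2 : F u t = (F u t - F 0 t) + F 0 t := by abel
      rw [h2]
      exact (norm_add_le _ _).trans (add_le_add h1 (hC t)))
  have hG : ContractingWith (1 / 2) G := by
    refine ⟨?_, LipschitzWith.of_dist_le_mul fun u v => ?_⟩
    · rw [← NNReal.coe_lt_coe]
      norm_num
    · rw [BoundedContinuousFunction.dist_le (by positivity)]
      intro t
      rw [dist_eq_norm, dist_eq_norm]
      simpa [G] using hl u v t
  refine ⟨ContractingWith.fixedPoint G hG, fun t => ?_⟩
  have h := (ContractingWith.fixedPoint_isFixedPt (f := G) (hf := hG))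
  conv_lhs => rw [← h]
  rfl

/-- A linear differential equation on `ℝ` with continuous coefficients has a global solution to
every initial value. -/
theorem exists_hasDerivAt_linear {E : Type*} [NormedAddCommGroup E] [NormedSpace ℝ E]
    [CompleteSpace E] (N : ℝ → E →L[ℝ] E) (hN : Continuous N) (y₀ : E) :
    ∃ y : ℝ → E, y 0 = y₀ ∧ ∀ t, HasDerivAt y (N t (y t)) t := by
  set P : ℝ → ℝ := fun t => ∫ s in (0 : ℝ)..t, 2 * ‖N s‖ with hP
  have hPd : ∀ t, HasDerivAt P (2 * ‖N t‖) t := fun t => by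
    have hcont : Continuous fun s => 2 * ‖N s‖ := by fun_prop
    exact hcont.integral_hasStrictDerivAt 0 t |>.hasDerivAt
  have hPc : Continuous P := continuous_iff_continuousAt.2 fun t => (hPd t).continuousAt
  have hP0 : P 0 = 0 := by simp [hP]
  -- A weighted sup norm replaces step-by-step continuation. Since `W` is `2 cosh P` with `P' =
  -- 2‖N‖`, the integral of `‖N‖ W` from `0` is `sinh P`, which is at most `W / 2` in absolute value
  -- on both sides of `0`. This is the contraction constant.
  set W : ℝ → ℝ := fun t => Real.exp (P t) + Real.exp (-P t) with hW
  have hWc : Continuous W := by fun_prop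
  have hWpos : ∀ t, 0 < W t := fun t => by positivity
  have hW1 : ∀ t, 1 ≤ W t := fun t => by
    have h1 := Real.add_one_le_exp (P t)
    have h2 := Real.add_one_le_exp (-P t)
    simp only [hW]; linarith
  have hWi : ∀ t, ∫ s in (0 : ℝ)..t, 2 * ‖N s‖ * W s = Real.exp (P t) - Real.exp (-P t) := by
    intro t
    rw [intervalIntegral.integral_eq_sub_of_hasDerivAt
      (f := fun t => Real.exp (P t) - Real.exp (-P t))]
    · simp [hP0]
    · intro s _
      have h1 : HasDerivAt (fun t => Real.exp (-P t)) (Real.exp (-P s) * -(2 * ‖N s‖)) s :=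
        (hPd s).fun_neg.exp
      refine ((hPd s).exp.fun_sub h1).congr_deriv ?_
      simp only [hW]
      ring
    · exact (by fun_prop : Continuous fun s => 2 * ‖N s‖ * W s).intervalIntegrable _ _
  have hWi' : ∀ t, |∫ s in (0 : ℝ)..t, ‖N s‖ * W s| ≤ 1 / 2 * W t := by
    intro t
    have h1 : ∫ s in (0 : ℝ)..t, 2 * ‖N s‖ * W s = 2 * ∫ s in (0 : ℝ)..t, ‖N s‖ * W s := by
      rw [← intervalIntegral.integral_const_mul]
      simp only [mul_assoc]
    have h2 := hWi t
    rw [h1] at h2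
    have h3 := Real.exp_pos (P t)
    have h4 := Real.exp_pos (-P t)
    rw [abs_le]
    simp only [hW]
    constructor <;> linarith
  have hcu : ∀ u : BoundedContinuousFunction ℝ E, Continuous fun s => N s (W s • u s) :=
    fun u => hN.clm_apply (hWc.smul u.continuous)
  obtain ⟨u, hu⟩ := exists_fixed_boundedContinuousFunction
    (fun (u : BoundedContinuousFunction ℝ E) t =>
      (W t)⁻¹ • (y₀ + ∫ s in (0 : ℝ)..t, N s (W s • u s)))
    (fun u => by
      refine (hWc.inv₀ fun t => (hWpos t).ne').smul (continuous_const.add ?_)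
      exact continuous_iff_continuousAt.2 fun t =>
        ((hcu u).integral_hasStrictDerivAt 0 t).hasDerivAt.continuousAt)
    ⟨‖y₀‖, fun t => by
      simp only [BoundedContinuousFunction.coe_zero, Pi.zero_apply, smul_zero, map_zero,
        intervalIntegral.integral_zero, add_zero, norm_smul, norm_inv, Real.norm_eq_abs,
        abs_of_pos (hWpos t)]
      exact mul_le_of_le_one_left (norm_nonneg _) (inv_le_one_of_one_le₀ (hW1 t))⟩
    (fun u v t => by
      rw [← smul_sub, add_sub_add_left_eq_sub, ← intervalIntegral.integral_sub
        ((hcu u).intervalIntegrable _ _) ((hcu v).intervalIntegrable _ _), norm_smul, norm_inv,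
        Real.norm_eq_abs, abs_of_pos (hWpos t)]
      have h1 : ‖∫ s in (0 : ℝ)..t, (N s (W s • u s) - N s (W s • v s))‖
          ≤ |∫ s in (0 : ℝ)..t, ‖N s‖ * W s * ‖u - v‖| := by
        refine intervalIntegral.norm_integral_le_abs_of_norm_le (Eventually.of_forall fun s => ?_)
          ((by fun_prop : Continuous fun s => ‖N s‖ * W s * ‖u - v‖).intervalIntegrable _ _)
        rw [← map_sub, ← smul_sub]
        refine ((N s).le_opNorm _).trans ?_
        rw [norm_smul, Real.norm_eq_abs, abs_of_pos (hWpos s), mul_assoc]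
        gcongr
        exact (u - v).norm_coe_le_norm s
      rw [intervalIntegral.integral_mul_const, abs_mul, abs_of_nonneg (norm_nonneg _)] at h1
      have h2 := h1.trans (mul_le_mul_of_nonneg_right (hWi' t) (norm_nonneg _))
      rw [inv_mul_le_iff₀ (hWpos t)]
      linarith)
  have huy : ∀ t, W t • u t = y₀ + ∫ s in (0 : ℝ)..t, N s (W s • u s) := fun t => by
    conv_lhs => rw [hu t]
    rw [smul_inv_smul₀ (hWpos t).ne']
  refine ⟨fun t => W t • u t, ?_, fun t => ?_⟩
  · exact (huy 0).trans (by rw [intervalIntegral.integral_same, add_zero])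
  · have := ((hcu u).integral_hasStrictDerivAt 0 t).hasDerivAt.const_add y₀
    exact this.congr_of_eventuallyEq (Eventually.of_forall huy)

/-- A linear differential equation on `(0, ∞)` with continuous coefficients has a global solution
to every initial value. -/
theorem exists_hasDerivAt_linear_Ioi {E : Type*} [NormedAddCommGroup E] [NormedSpace ℝ E]
    [CompleteSpace E] (N : ℝ → E →L[ℝ] E) (hN : ContinuousOn N (Ioi 0)) {r₀ : ℝ} (hr₀ : 0 < r₀)
    (y₀ : E) : ∃ y : ℝ → E, y r₀ = y₀ ∧ ∀ r, 0 < r → HasDerivAt y (N r (y r)) r := by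
  -- The substitution `r = r₀ * exp t` maps `ℝ` onto `(0, ∞)` and multiplies the coefficient by `r`.
  obtain ⟨Y, hY0, hY⟩ := exists_hasDerivAt_linear
    (fun t => (r₀ * Real.exp t) • N (r₀ * Real.exp t))
    ((by fun_prop : Continuous fun t => r₀ * Real.exp t).smul
      (hN.comp_continuous (by fun_prop) fun t => mul_pos hr₀ (Real.exp_pos t))) y₀
  refine ⟨fun r => Y (Real.log (r / r₀)), ?_, fun r hr => ?_⟩
  · simp [hr₀.ne', hY0]
  · have hq : 0 < r / r₀ := by positivity
    have h1 : HasDerivAt (fun r => Real.log (r / r₀)) (1 / r₀ / (r / r₀)) r :=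
      ((hasDerivAt_id r).div_const r₀).log hq.ne'
    have h2 := (hY (Real.log (r / r₀))).scomp r h1
    rw [Real.exp_log hq, mul_div_cancel₀ _ hr₀.ne', _root_.smul_apply, smul_smul] at h2
    have h3 : 1 / r₀ / (r / r₀) * r = 1 := by field_simp
    rwa [h3, one_smul] at h2

/-- A solution of a linear system on an interval in `(0, ∞)` extends to a solution on `(0, ∞)`. -/
theorem exists_extension_of_hasDerivAt {n : Type*} [Fintype n] [DecidableEq n]
    {M : ℝ → Matrix n n ℂ} (hM : ContinuousOn M (Ioi 0)) {S : Set ℝ} (hS : S ⊆ Ioi 0)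
    (hSc : S.OrdConnected) {z : ℝ → n → ℂ} (hz : ∀ r ∈ S, HasDerivAt z (M r *ᵥ z r) r) :
    ∃ y : ℝ → n → ℂ, (∀ r, 0 < r → HasDerivAt y (M r *ᵥ y r) r) ∧ EqOn y z S := by
  let L : Matrix n n ℂ →ₗ[ℝ] (n → ℂ) →L[ℝ] (n → ℂ) :=
    { toFun := fun A => LinearMap.toContinuousLinearMap ((Matrix.mulVecLin A).restrictScalars ℝ)
      map_add' := fun A B => by ext; simp
      map_smul' := fun c A => by ext; simp }
  have hL : Continuous L := LinearMap.continuous_of_finiteDimensional L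
  have hLM : ContinuousOn (fun r => L (M r)) (Ioi 0) := hL.comp_continuousOn hM
  rcases S.eq_empty_or_nonempty with rfl | ⟨r₀, hr₀⟩
  · obtain ⟨y, -, hy⟩ := exists_hasDerivAt_linear_Ioi _ hLM one_pos 0
    exact ⟨y, hy, fun _ h => h.elim⟩
  · obtain ⟨y, hy0, hy⟩ := exists_hasDerivAt_linear_Ioi _ hLM (hS hr₀) (z r₀)
    refine ⟨y, hy, fun r hr => ?_⟩
    have hlip : ∀ a b : ℝ, Icc a b ⊆ S → ∃ K, ∀ t ∈ Icc a b,
        LipschitzOnWith K (fun v => M t *ᵥ v) univ := by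
      intro a b hab
      obtain ⟨C, hC⟩ := (isCompact_Icc (a := a) (b := b)).exists_bound_of_continuousOn
        (hLM.mono (hab.trans hS))
      refine ⟨C.toNNReal, fun t ht => ?_⟩
      have h1 := (L (M t)).lipschitz.weaken (K' := C.toNNReal)
        (NNReal.coe_le_coe.1 ((hC t ht).trans (Real.le_coe_toNNReal C)))
      exact h1.lipschitzOnWith
    rcases le_total r₀ r with h | h
    · have hsub : Icc r₀ r ⊆ S := hSc.out hr₀ hr
      obtain ⟨K, hK⟩ := hlip _ _ hsub
      exact ODE_solution_unique_of_mem_Icc_right (s := fun _ => univ)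
        (fun t ht => hK t (Ico_subset_Icc_self ht))
        (fun t ht => (hy t (hS (hsub ht))).continuousAt.continuousWithinAt)
        (fun t ht => (hy t (hS (hsub (Ico_subset_Icc_self ht)))).hasDerivWithinAt)
        (fun _ _ => trivial)
        (fun t ht => (hz t (hsub ht)).continuousAt.continuousWithinAt)
        (fun t ht => (hz t (hsub (Ico_subset_Icc_self ht))).hasDerivWithinAt)
        (fun _ _ => trivial) hy0 (right_mem_Icc.2 h)
    · have hsub : Icc r r₀ ⊆ S := hSc.out hr hr₀
      obtain ⟨K, hK⟩ := hlip _ _ hsub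
      exact ODE_solution_unique_of_mem_Icc_left (s := fun _ => univ)
        (fun t ht => hK t (Ioc_subset_Icc_self ht))
        (fun t ht => (hy t (hS (hsub ht))).continuousAt.continuousWithinAt)
        (fun t ht => (hy t (hS (hsub (Ioc_subset_Icc_self ht)))).hasDerivWithinAt)
        (fun _ _ => trivial)
        (fun t ht => (hz t (hsub ht)).continuousAt.continuousWithinAt)
        (fun t ht => (hz t (hsub (Ioc_subset_Icc_self ht))).hasDerivWithinAt)
        (fun _ _ => trivial) hy0 (left_mem_Icc.2 h)

/-! ### Levinson's theorem -/

/-- Solution operator of `(x / e)' = F / e` on `(T, ∞)` for a monotone weight `e`: with the weight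
decaying, one integrates from `T`, and else from infinity. -/
theorem exists_weighted_primitive {e ρ : ℝ → ℝ} (he : Continuous e) (hpos : ∀ t, 0 < e t)
    (hmono : (Antitone e ∧ Tendsto e atTop (𝓝 0)) ∨ Monotone e) {T : ℝ}
    (hρ : IntegrableOn ρ (Ioi T)) :
    ∃ Λ : (ℝ → ℂ) → ℝ → ℂ, ∀ F : ℝ → ℂ, Continuous F → ∀ C : ℝ, (∀ t, ‖F t‖ ≤ C * ρ t) →
      Continuous (Λ F) ∧ (∀ t, ‖Λ F t‖ ≤ C * ∫ s in Ioi T, ρ s) ∧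
      Tendsto (Λ F) atTop (𝓝 0) ∧
      (∀ t, T < t → HasDerivAt (fun t => Λ F t / e t) (F t / e t) t) ∧
      ∀ G : ℝ → ℂ, Continuous G → ∀ D : ℝ, (∀ t, ‖G t‖ ≤ D * ρ t) →
        ∀ t, Λ F t - Λ G t = Λ (fun s => F s - G s) t := by
  have hcd : ∀ F : ℝ → ℂ, Continuous F → Continuous fun s => F s / (e s : ℂ) := fun F hF =>
    hF.div (Complex.continuous_ofReal.comp he) fun t => Complex.ofReal_ne_zero.2 (hpos t).ne'
  have hnorm : ∀ (F : ℝ → ℂ) t s, e t ≤ e s → ‖(e t : ℂ) * (F s / e s)‖ ≤ ‖F s‖ := by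
    intro F t s hts
    rw [norm_mul, norm_div, Complex.norm_of_nonneg (hpos t).le, Complex.norm_of_nonneg (hpos s).le,
      mul_div_assoc', div_le_iff₀ (hpos s), mul_comm]
    exact mul_le_mul_of_nonneg_left hts (norm_nonneg _)
  rcases hmono with ⟨hanti, hlim⟩ | hmono
  -- For `T ≤ s ≤ t` the ratio `e t / e s` is at most `1`, so the integrand is dominated by `C * ρ`.
  -- The `max` freezes the function to the left of `T`, which keeps it continuous and bounded on the
  -- whole line.
  · refine ⟨fun F t => e (max t T) * ∫ s in T..max t T, F s / e s, fun F hF C hC => ?_⟩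
    have hCρ : IntegrableOn (fun s => C * ρ s) (Ioi T) := hρ.const_mul C
    have hd : ∀ t, HasDerivAt (fun t => ∫ s in T..t, F s / (e s : ℂ)) (F t / e t) t :=
      fun t => ((hcd F hF).integral_hasStrictDerivAt T t).hasDerivAt
    have hC0 : ∀ s, 0 ≤ C * ρ s := fun s => (norm_nonneg _).trans (hC s)
    refine ⟨?_, fun t => ?_, ?_, fun t ht => ?_, fun G hG D hD t => ?_⟩
    · have h1 : Continuous fun t => ∫ s in T..t, F s / (e s : ℂ) :=
        continuous_iff_continuousAt.2 fun t => (hd t).continuousAt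
      exact (Complex.continuous_ofReal.comp (he.comp (by fun_prop))).mul (h1.comp (by fun_prop))
    · beta_reduce
      rw [← intervalIntegral.integral_const_mul, intervalIntegral.integral_of_le (le_max_right _ _),
        ← integral_const_mul]
      refine (norm_integral_le_of_norm_le (hCρ.mono_set Ioc_subset_Ioi_self) ?_).trans
        (setIntegral_mono_set hCρ (Eventually.of_forall hC0) Ioc_subset_Ioi_self.eventuallyLE)
      refine (ae_restrict_iff' measurableSet_Ioc).2 (Eventually.of_forall fun s hs => ?_)
      exact (hnorm F _ _ (hanti hs.2)).trans (hC s)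
    -- Dominated convergence: for fixed `s` the factor `e t / e s` tends to `0`.
    · have h1 : Tendsto (fun t => ∫ s in Ioi T,
          (Iic t).indicator (fun s => (e t : ℂ) * (F s / e s)) s) atTop
          (𝓝 (∫ s in Ioi T, (0 : ℂ))) := by
        refine tendsto_integral_filter_of_dominated_convergence (fun s => C * ρ s)
          (Eventually.of_forall fun t => ?_) (Eventually.of_forall fun t => ?_) hCρ
          (Eventually.of_forall fun s => ?_)
        · exact ((continuous_const.mul (hcd F hF)).aestronglyMeasurable).indicator measurableSet_Iic
        · refine Eventually.of_forall fun s => ?_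
          by_cases h : s ∈ Iic t
          · rw [indicator_of_mem h]
            exact (hnorm F _ _ (hanti h)).trans (hC s)
          · rw [indicator_of_notMem h, norm_zero]
            exact hC0 s
        · have h2 : Tendsto (fun t => (e t : ℂ) * (F s / e s)) atTop (𝓝 (((0 : ℝ) : ℂ) * (F s / e s))) :=
            ((Complex.continuous_ofReal.tendsto 0).comp hlim).mul_const _
          rw [Complex.ofReal_zero, zero_mul] at h2
          refine h2.congr' ?_
          filter_upwards [eventually_ge_atTop s] with t ht
          rw [indicator_of_mem (mem_Iic.2 ht)]
      rw [integral_zero] at h1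
      refine h1.congr' ?_
      filter_upwards [eventually_ge_atTop T] with t ht
      rw [max_eq_left ht, ← intervalIntegral.integral_const_mul, intervalIntegral.integral_of_le ht,
        setIntegral_indicator measurableSet_Iic, Ioi_inter_Iic]
    · refine (hd t).congr_of_eventuallyEq ?_
      filter_upwards [eventually_gt_nhds ht] with s hs
      rw [max_eq_left hs.le, mul_div_cancel_left₀ _ (Complex.ofReal_ne_zero.2 (hpos s).ne')]
    · simp only
      rw [← mul_sub, ← intervalIntegral.integral_sub ((hcd F hF).intervalIntegrable _ _)
        ((hcd G hG).intervalIntegrable _ _)]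
      simp only [sub_div]
  -- Now `e t / e s ≤ 1` holds for `s ≥ t`, which forces integration from infinity; the limit `0` is
  -- then the vanishing of a tail of the integral of `C * ρ`.
  · refine ⟨fun F t => -(e (max t T) * ∫ s in Ioi (max t T), F s / e s), fun F hF C hC => ?_⟩
    have hCρ : IntegrableOn (fun s => C * ρ s) (Ioi T) := hρ.const_mul C
    have hd : ∀ t, HasDerivAt (fun t => ∫ s in T..t, F s / (e s : ℂ)) (F t / e t) t :=
      fun t => ((hcd F hF).integral_hasStrictDerivAt T t).hasDerivAt
    have hC0 : ∀ s, 0 ≤ C * ρ s := fun s => (norm_nonneg _).trans (hC s)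
    have hint : ∀ (F : ℝ → ℂ), Continuous F → ∀ C : ℝ, (∀ t, ‖F t‖ ≤ C * ρ t) →
        IntegrableOn (fun s => F s / (e s : ℂ)) (Ioi T) := by
      intro F hF C hC
      refine Integrable.mono' ((hρ.const_mul C).div_const (e T))
        (hcd F hF).aestronglyMeasurable ?_
      refine (ae_restrict_iff' measurableSet_Ioi).2 (Eventually.of_forall fun s hs => ?_)
      rw [norm_div, Complex.norm_of_nonneg (hpos s).le]
      exact div_le_div₀ ((norm_nonneg _).trans (hC s)) (hC s) (hpos T) (hmono (le_of_lt hs))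
    have hsplit : ∀ t, T ≤ t → ∫ s in Ioi t, F s / (e s : ℂ)
        = (∫ s in Ioi T, F s / (e s : ℂ)) - ∫ s in T..t, F s / (e s : ℂ) := by
      intro t ht
      rw [eq_sub_iff_add_eq, add_comm]
      exact intervalIntegral.integral_interval_add_Ioi (hint F hF C hC)
        ((hint F hF C hC).mono_set (Ioi_subset_Ioi ht))
    have hb : ∀ t, T ≤ t → ‖(e t : ℂ) * ∫ s in Ioi t, F s / (e s : ℂ)‖
        ≤ ∫ s in Ioi t, C * ρ s := by
      intro t ht
      rw [← integral_const_mul]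
      refine norm_integral_le_of_norm_le (hCρ.mono_set (Ioi_subset_Ioi ht)) ?_
      refine (ae_restrict_iff' measurableSet_Ioi).2 (Eventually.of_forall fun s hs => ?_)
      exact (hnorm F _ _ (hmono (le_of_lt hs))).trans (hC s)
    refine ⟨?_, fun t => ?_, ?_, fun t ht => ?_, fun G hG D hD t => ?_⟩
    · have h1 : Continuous fun t => ∫ s in T..t, F s / (e s : ℂ) :=
        continuous_iff_continuousAt.2 fun t => (hd t).continuousAt
      simp only [hsplit _ (le_max_right _ _)]
      exact ((Complex.continuous_ofReal.comp (he.comp (by fun_prop))).mul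
        (continuous_const.sub (h1.comp (by fun_prop)))).neg
    · rw [norm_neg]
      refine (hb _ (le_max_right _ _)).trans ?_
      rw [← integral_const_mul]
      exact setIntegral_mono_set hCρ (Eventually.of_forall hC0)
        (Ioi_subset_Ioi (le_max_right _ _)).eventuallyLE
    · have h1 : Tendsto (fun t => (∫ s in Ioi T, C * ρ s) - ∫ s in T..t, C * ρ s) atTop
          (𝓝 ((∫ s in Ioi T, C * ρ s) - ∫ s in Ioi T, C * ρ s)) :=
        tendsto_const_nhds.sub (intervalIntegral_tendsto_integral_Ioi T hCρ tendsto_id)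
      rw [sub_self] at h1
      refine squeeze_zero_norm' ?_ h1
      filter_upwards [eventually_ge_atTop T] with t ht
      rw [max_eq_left ht, norm_neg]
      refine (hb t ht).trans (le_of_eq ?_)
      rw [eq_sub_iff_add_eq, add_comm]
      exact intervalIntegral.integral_interval_add_Ioi hCρ (hCρ.mono_set (Ioi_subset_Ioi ht))
    · have h1 := ((hd t).const_sub (∫ s in Ioi T, F s / (e s : ℂ))).fun_neg
      rw [neg_neg] at h1
      refine h1.congr_of_eventuallyEq ?_
      filter_upwards [eventually_gt_nhds ht] with s hs
      rw [max_eq_left hs.le, ← hsplit s hs.le, neg_div,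
        mul_div_cancel_left₀ _ (Complex.ofReal_ne_zero.2 (hpos s).ne')]
    · have h1 := integral_sub ((hint F hF C hC).mono_set (Ioi_subset_Ioi (le_max_right t T)))
        ((hint G hG D hD).mono_set (Ioi_subset_Ioi (le_max_right t T)))
      simp only [sub_div]
      rw [h1]
      ring

/-- Levinson's theorem for the perturbation of a diagonal system, with the weights `E k` in the
place of the quotients of the exponential factors; version with hypotheses on the whole line. -/
theorem exists_asymptotic_of_small {ι : Type*} [Fintype ι] [DecidableEq ι] (i : ι)
    {E : ι → ℝ → ℝ} {P : ι → ι → ℝ → ℂ} {ρ : ℝ → ℝ} {T : ℝ}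
    (hE : ∀ k, Continuous (E k)) (hpos : ∀ k t, 0 < E k t) (hEi : ∀ t, E i t = 1)
    (hmono : ∀ k, (Antitone (E k) ∧ Tendsto (E k) atTop (𝓝 0)) ∨ Monotone (E k))
    (hP : ∀ k l, Continuous (P k l)) (hPρ : ∀ k l t, ‖P k l t‖ ≤ ρ t)
    (hρ : IntegrableOn ρ (Ioi T)) (hsmall : Fintype.card ι * ∫ s in Ioi T, ρ s ≤ 1 / 2) :
    ∃ x : ι → ℝ → ℂ, (∀ k, Tendsto (x k) atTop (𝓝 (if k = i then 1 else 0))) ∧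
      ∀ k t, T < t → HasDerivAt (fun t => x k t / E k t) ((∑ l, P k l t * x l t) / E k t) t := by
  choose Λ hΛ using fun k => exists_weighted_primitive (hE k) (hpos k) (hmono k) hρ
  set H : ι → BoundedContinuousFunction ℝ (ι → ℂ) → ℝ → ℂ := fun k u t => ∑ l, P k l t * u t l
    with hH
  have hHc : ∀ k u, Continuous (H k u) := fun k u =>
    continuous_finsetSum _ fun l _ => (hP k l).mul ((continuous_apply l).comp u.continuous)
  have hHb : ∀ k u t, ‖H k u t‖ ≤ Fintype.card ι * ‖u‖ * ρ t := by
    intro k u t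
    refine (norm_sum_le _ _).trans ?_
    refine (Finset.sum_le_card_nsmul _ _ (ρ t * ‖u‖) fun l _ => ?_).trans (le_of_eq ?_)
    · rw [norm_mul]
      exact mul_le_mul (hPρ k l t) ((norm_le_pi_norm _ l).trans (u.norm_coe_le_norm t))
        (norm_nonneg _) ((norm_nonneg _).trans (hPρ k l t))
    · rw [nsmul_eq_mul, Finset.card_univ]
      ring
  have hHsub : ∀ k u v, (fun t => H k u t - H k v t) = H k (u - v) := by
    intro k u v
    funext t
    simp only [hH, ← Finset.sum_sub_distrib, ← mul_sub]
    rfl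
  have hHz : ∀ k t, ‖Λ k (H k 0) t‖ ≤ 0 := by
    intro k t
    have := (hΛ k (H k 0) (hHc k 0) _ (hHb k 0)).2.1 t
    simpa using this
  -- The integral equation is `u k = δ k i + Λ k (H k u)`. A sum of `Fintype.card ι` terms bounded
  -- by `ρ * ‖u‖` gives the contraction constant that `hsmall` bounds by `1/2`.
  obtain ⟨u, hu⟩ := exists_fixed_boundedContinuousFunction
    (fun (u : BoundedContinuousFunction ℝ (ι → ℂ)) t k =>
      (if k = i then 1 else 0) + Λ k (H k u) t)
    (fun u => continuous_pi fun k => continuous_const.add (hΛ k _ (hHc k u) _ (hHb k u)).1)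
    ⟨1, fun t => by
      refine (pi_norm_le_iff_of_nonneg zero_le_one).2 fun k => ?_
      rw [norm_le_zero_iff.1 (hHz k t), add_zero]
      split_ifs <;> simp⟩
    (fun u v t => by
      refine (pi_norm_le_iff_of_nonneg (by positivity)).2 fun k => ?_
      simp only [Pi.sub_apply, add_sub_add_left_eq_sub]
      rw [(hΛ k _ (hHc k u) _ (hHb k u)).2.2.2.2 _ (hHc k v) _ (hHb k v), hHsub]
      refine ((hΛ k _ (hHc k (u - v)) _ (hHb k (u - v))).2.1 t).trans ?_
      calc _ = (Fintype.card ι * ∫ s in Ioi T, ρ s) * ‖u - v‖ := by ring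
        _ ≤ _ := mul_le_mul_of_nonneg_right hsmall (norm_nonneg _))
  have hu' : ∀ t k, u t k = (if k = i then 1 else 0) + Λ k (H k u) t := fun t k => by
    conv_lhs => rw [hu t]
  refine ⟨fun k t => u t k, fun k => ?_, fun k t ht => ?_⟩
  · have h1 := (hΛ k _ (hHc k u) _ (hHb k u)).2.2.1.const_add (if k = i then (1 : ℂ) else 0)
    rw [add_zero] at h1
    exact h1.congr fun t => (hu' t k).symm
  · have h1 := (hΛ k _ (hHc k u) _ (hHb k u)).2.2.2.1 t ht
    -- Divided by `E k`, the inhomogeneous term stays constant because `E i = 1`, so it drops out of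
    -- the derivative.
    have h2 : ∀ t, ((if k = i then 1 else 0 : ℂ)) / (E k t : ℂ) = if k = i then 1 else 0 := by
      intro t
      split_ifs with h
      · rw [h, hEi, Complex.ofReal_one, div_one]
      · rw [zero_div]
    refine (h1.const_add (if k = i then 1 else 0)).congr_of_eventuallyEq
      (Eventually.of_forall fun s => ?_)
    beta_reduce
    rw [hu' s k, add_div, h2]

/-- Levinson's theorem at infinity, for a system `c' = Q c` whose coefficients are small with
respect to weights `g k` with monotone quotients. -/
theorem exists_asymptotic_atTop {ι : Type*} [Fintype ι] [DecidableEq ι] (i : ι)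
    {g : ι → ℝ → ℝ} {Q : ι → ι → ℝ → ℂ} {ρ : ℝ → ℝ} {T : ℝ}
    (hg : ∀ k, ContinuousOn (g k) (Ici T)) (hpos : ∀ k t, T ≤ t → 0 < g k t)
    (hmono : ∀ k, (AntitoneOn (fun t => g k t / g i t) (Ici T) ∧
        Tendsto (fun t => g k t / g i t) atTop (𝓝 0)) ∨
      MonotoneOn (fun t => g k t / g i t) (Ici T))
    (hQ : ∀ k l, ContinuousOn (Q k l) (Ici T))
    (hQρ : ∀ k l t, T ≤ t → ‖Q k l t‖ * g k t ≤ ρ t * g l t)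
    (hρ : IntegrableOn ρ (Ioi T)) :
    ∃ (c : ι → ℝ → ℂ) (T' : ℝ), T ≤ T' ∧
      (∀ k, Tendsto (fun t => c k t * (g k t / g i t : ℝ)) atTop (𝓝 (if k = i then 1 else 0))) ∧
      ∀ k t, T' < t → HasDerivAt (c k) (∑ l, Q k l t * c l t) t := by
  obtain ⟨T', hT', hsmall⟩ : ∃ T' ≥ T, Fintype.card ι * ∫ s in Ioi T', ρ s ≤ 1 / 2 := by
    have h1 : Tendsto (fun t => Fintype.card ι * ((∫ s in Ioi T, ρ s) - ∫ s in T..t, ρ s)) atTop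
        (𝓝 (Fintype.card ι * ((∫ s in Ioi T, ρ s) - ∫ s in Ioi T, ρ s))) :=
      (tendsto_const_nhds.sub (intervalIntegral_tendsto_integral_Ioi T hρ tendsto_id)).const_mul _
    rw [sub_self, mul_zero] at h1
    obtain ⟨t, h2, h3⟩ := ((h1.eventually (gt_mem_nhds (by norm_num : (0 : ℝ) < 1 / 2))).and
      (eventually_ge_atTop T)).exists
    refine ⟨t, h3, le_of_lt (lt_of_eq_of_lt ?_ h2)⟩
    rw [eq_comm, ← intervalIntegral.integral_interval_add_Ioi hρ (hρ.mono_set (Ioi_subset_Ioi h3))]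
    ring
  have hmem : ∀ t, T ≤ max t T' := fun t => hT'.trans (le_max_right _ _)
  have hcont : ∀ {X : Type _} [TopologicalSpace X] {f : ℝ → X}, ContinuousOn f (Ici T) →
      Continuous fun t => f (max t T') := fun hf =>
    hf.comp_continuous (by fun_prop) hmem
  have hgp : ∀ k t, 0 < g k (max t T') := fun k t => hpos k _ (hmem t)
  -- The unknowns are `x k = c k * g k / g i`, so that `x k / E k` is `c k`. Everything is frozen to
  -- the left of `T'` to meet the hypotheses on the whole line.
  obtain ⟨x, hx, hx'⟩ := exists_asymptotic_of_small i
    (E := fun k t => g k (max t T') / g i (max t T'))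
    (P := fun k l t => Q k l (max t T') * (g k (max t T') / g l (max t T') : ℝ))
    (ρ := fun t => ρ (max t T')) (T := T')
    (fun k => (hcont (hg k)).div (hcont (hg i)) fun t => (hgp i t).ne')
    (fun k t => div_pos (hgp k t) (hgp i t)) (fun t => div_self (hgp i t).ne')
    (fun k => by
      rcases hmono k with ⟨h1, h2⟩ | h1
      · refine Or.inl ⟨fun s t hst => h1 (hmem s) (hmem t) (max_le_max_right _ hst), ?_⟩
        exact h2.comp (tendsto_atTop_mono (fun t => le_max_left t T') tendsto_id)
      · exact Or.inr fun s t hst => h1 (hmem s) (hmem t) (max_le_max_right _ hst))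
    (fun k l => (hcont (hQ k l)).mul (Complex.continuous_ofReal.comp
      ((hcont (hg k)).div (hcont (hg l)) fun t => (hgp l t).ne')))
    (fun k l t => by
      rw [norm_mul, Complex.norm_of_nonneg (div_pos (hgp k t) (hgp l t)).le, ← mul_div_assoc,
        div_le_iff₀ (hgp l t)]
      exact hQρ k l _ (hmem t))
    ((hρ.mono_set (Ioi_subset_Ioi hT')).congr_fun (fun t ht => by
      rw [max_eq_left (le_of_lt ht)]) measurableSet_Ioi)
    (by
      rwa [setIntegral_congr_fun (g := ρ) measurableSet_Ioi fun t ht => by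
        rw [max_eq_left (le_of_lt ht)]])
  have hne : ∀ k t, T' < t → (g k t : ℂ) ≠ 0 := fun k t ht =>
    Complex.ofReal_ne_zero.2 (hpos k t (hT'.trans ht.le)).ne'
  refine ⟨fun k t => x k t / (g k t / g i t : ℝ), T', hT', fun k => ?_, fun k t ht => ?_⟩
  · refine (hx k).congr' ?_
    filter_upwards [eventually_gt_atTop T'] with t ht
    have h1 := hne k t ht
    have h2 := hne i t ht
    push_cast
    field_simp
  · have h1 := hx' k t ht
    refine (h1.congr_of_eventuallyEq ?_).congr_deriv ?_
    · filter_upwards [eventually_gt_nhds ht] with s hs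
      rw [max_eq_left hs.le]
    · rw [max_eq_left ht.le, Finset.sum_div]
      refine Finset.sum_congr rfl fun l _ => ?_
      have h1 := hne k t ht
      have h2 := hne i t ht
      have h3 := hne l t ht
      push_cast
      field_simp

/-- Levinson's theorem at zero, for a system `c' = Q c` whose coefficients are small with respect
to powers of `r`. -/
theorem exists_asymptotic_nhdsGT_zero {ι : Type*} [Fintype ι] [DecidableEq ι] (i : ι)
    {σ : ι → ℝ} {Q : ι → ι → ℝ → ℂ} {C r₀ : ℝ} (hr₀ : 0 < r₀) (hr₁ : r₀ ≤ 1)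
    (hQ : ∀ k l, ContinuousOn (Q k l) (Ioc 0 r₀))
    (hQC : ∀ k l r, 0 < r → r ≤ r₀ → ‖Q k l r‖ ≤ C * r ^ (1 / 2 + σ l - σ k)) :
    ∃ (c : ι → ℝ → ℂ) (r₁ : ℝ), 0 < r₁ ∧ Tendsto (c i) (𝓝[>] 0) (𝓝 1) ∧
      (∀ k, k ≠ i → Tendsto (fun r => c k r * (r ^ (σ k - σ i - 1) : ℝ)) (𝓝[>] 0) (𝓝 0)) ∧
      ∀ k r, 0 < r → r < r₁ → HasDerivAt (c k) (∑ l, Q k l r * c l r) r := by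
  have hC : 0 ≤ C := by
    have h1 := (norm_nonneg _).trans (hQC i i r₀ hr₀ le_rfl)
    exact nonneg_of_mul_nonneg_left h1 (Real.rpow_pos_of_pos hr₀ _)
  -- Lowering the exponents with `k ≠ i` by one forces the other coefficients to be smaller by a
  -- full power of `r`.
  set τ : ι → ℝ := fun k => σ k - if k = i then 0 else 1 with hτ
  have hT : 1 ≤ r₀⁻¹ := (one_le_inv₀ hr₀).2 hr₁
  have hpos : ∀ t, r₀⁻¹ ≤ t → 0 < t := fun t ht => by linarith
  have hle : ∀ t, r₀⁻¹ ≤ t → t⁻¹ ≤ r₀ := fun t ht => inv_le_of_inv_le₀ hr₀ ht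
  have hquot : ∀ k (t : ℝ), 0 < t → t ^ (-τ k) / t ^ (-τ i) = t ^ (τ i - τ k) := fun k t ht => by
    rw [← Real.rpow_sub ht]
    congr 1
    ring
  obtain ⟨c, T', hT', hc, hc'⟩ := exists_asymptotic_atTop i (g := fun k t => t ^ (-τ k))
    (Q := fun k l t => -((t ^ 2)⁻¹ : ℝ) * Q k l t⁻¹) (ρ := fun t => C * t ^ (-(3 / 2) : ℝ))
    (T := r₀⁻¹)
    (fun k t ht => (Real.continuousAt_rpow_const _ _ (Or.inl (hpos t ht).ne')).continuousWithinAt)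
    (fun k t ht => Real.rpow_pos_of_pos (hpos t ht) _)
    (fun k => by
      rcases lt_or_ge (τ i - τ k) 0 with h | h
      · refine Or.inl ⟨fun s hs t ht hst => ?_, ?_⟩
        · simp only [hquot k _ (hpos s hs), hquot k _ (hpos t ht)]
          exact Real.rpow_le_rpow_of_nonpos (hpos s hs) hst h.le
        · have h1 := tendsto_rpow_neg_atTop (neg_pos.2 h)
          rw [neg_neg] at h1
          refine h1.congr' ?_
          filter_upwards [eventually_gt_atTop 0] with t ht
          rw [hquot k t ht]
      · refine Or.inr fun s hs t ht hst => ?_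
        simp only [hquot k _ (hpos s hs), hquot k _ (hpos t ht)]
        exact Real.rpow_le_rpow (hpos s hs).le hst h)
    (fun k l => by
      have h1 : ContinuousOn (fun t : ℝ => t⁻¹) (Ici r₀⁻¹) :=
        continuousOn_inv₀.mono fun t ht => (hpos t ht).ne'
      have h2 : ContinuousOn (fun t : ℝ => (t ^ 2)⁻¹) (Ici r₀⁻¹) :=
        ContinuousOn.inv₀ (by fun_prop) fun t ht => (pow_pos (hpos t ht) 2).ne'
      exact (Complex.continuous_ofReal.comp_continuousOn h2).neg.mul ((hQ k l).comp h1
        fun t ht => ⟨inv_pos.2 (hpos t ht), hle t ht⟩))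
    (fun k l t ht => by
      have ht0 := hpos t ht
      have h1 := hQC k l t⁻¹ (inv_pos.2 ht0) (hle t ht)
      rw [norm_mul, norm_neg, Complex.norm_of_nonneg (by positivity)]
      calc (t ^ 2)⁻¹ * ‖Q k l t⁻¹‖ * t ^ (-τ k)
          ≤ (t ^ 2)⁻¹ * (C * t⁻¹ ^ (1 / 2 + σ l - σ k)) * t ^ (-τ k) := by gcongr
        _ = C * t ^ (-2 + -(1 / 2 + σ l - σ k) + -τ k) := by
          rw [Real.rpow_add ht0, Real.rpow_add ht0, Real.inv_rpow ht0.le, Real.rpow_neg ht0.le 2,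
            ← Real.rpow_neg ht0.le (1 / 2 + σ l - σ k), Real.rpow_two]
          ring
        -- The Jacobian `t⁻²` and the factor `r^(1/2)` give `t^(-5/2)`. The shift in `τ` costs at
        -- most one power, with equality when `k ≠ i` and `l = i`, and `t^(-3/2)` is still
        -- integrable.
        _ ≤ C * t ^ (-(3 / 2) + -τ l) := by
          refine mul_le_mul_of_nonneg_left
            (Real.rpow_le_rpow_of_exponent_le (by linarith) ?_) hC
          simp only [hτ]
          split_ifs <;> linarith
        _ = C * t ^ (-(3 / 2) : ℝ) * t ^ (-τ l) := by rw [Real.rpow_add ht0, mul_assoc])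
    ((integrableOn_Ioi_rpow_of_lt (by norm_num) (inv_pos.2 hr₀)).const_mul C)
  have hT0 : 0 < T' := by linarith
  have key : ∀ k, Tendsto (fun r => c k r⁻¹ * (r ^ (τ k - τ i) : ℝ)) (𝓝[>] 0)
      (𝓝 (if k = i then 1 else 0)) := fun k => by
    refine ((hc k).comp tendsto_inv_nhdsGT_zero).congr' ?_
    filter_upwards [self_mem_nhdsWithin] with r hr
    have hr' : (0 : ℝ) < r := hr
    rw [Function.comp_apply, hquot k _ (inv_pos.2 hr'), Real.inv_rpow hr'.le,
      ← Real.rpow_neg hr'.le, neg_sub]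
  refine ⟨fun k r => c k r⁻¹, T'⁻¹, inv_pos.2 hT0, ?_, fun k hk => ?_, fun k r hr hr' => ?_⟩
  · simpa using key i
  · have h1 := key k
    simp only [hτ, if_neg hk, if_true] at h1
    convert h1 using 5
    ring
  · have hr2 : T' < r⁻¹ := (lt_inv_comm₀ hT0 hr).2 hr'
    refine ((hc' k r⁻¹ hr2).scomp r (hasDerivAt_inv hr.ne')).congr_deriv ?_
    have hrc : (r : ℂ) ≠ 0 := Complex.ofReal_ne_zero.2 hr.ne'
    rw [Finset.smul_sum]
    refine Finset.sum_congr rfl fun l _ => ?_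
    simp only [inv_inv, Complex.real_smul]
    push_cast
    field_simp

/-! ### Variation of parameters in modes -/

/-- The vector with value `a` and derivative `b` in the block of the index `k`: the indices `0, 2`
belong to the plus block and the indices `1, 3` to the minus block. -/
def modeVector (k : Fin 4) (a b : ℂ) : Fin 4 → ℂ :=
  ![![a, b, 0, 0], ![0, 0, a, b], ![a, b, 0, 0], ![0, 0, a, b]] k

/-- The angular exponent in the block of the index `k`. -/
def blockExponent (j : ℤ) (m : ℝ) : Fin 4 → ℝ :=
  ![(j : ℝ) + m, (j : ℝ) - m, (j : ℝ) + m, (j : ℝ) - m]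

/-- The parameter `α₊` or `α₋`, according to the block of the index `k`. -/
def blockAlpha (μ : ℝ) (lam : ℂ) : Fin 4 → ℂ :=
  ![alphaPlus μ lam, alphaMinus μ lam, alphaPlus μ lam, alphaMinus μ lam]

/-- The sign that distinguishes the two approximate solutions in one block. -/
def modeSign : Fin 4 → ℝ := ![1, 1, -1, -1]

/-- The coefficient with which the `l`-th mode enters the residual in the block of `k`, if
`u'' + u' / r = D l * u` for the `l`-th mode. -/
noncomputable def modeResidual (w : ℝ → ℝ) (j : ℤ) (m μ : ℝ) (lam : ℂ) (D : Fin 4 → ℝ → ℂ) (k l : Fin 4) (r : ℝ) :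
    ℂ :=
  if k = l ∨ k = l + 2 then
    ((blockExponent j m k ^ 2 / r ^ 2 + r ^ 2 : ℝ) : ℂ) - 2 * blockAlpha μ lam k
      + 4 * ((w r ^ 2 : ℝ) : ℂ) - D l r
  else 2 * ((w r ^ 2 : ℝ) : ℂ)

/-- The Wronskian of the two modes in the block of `k`. -/
def modeWronskian (u p : Fin 4 → ℝ → ℂ) (k : Fin 4) (r : ℝ) : ℂ :=
  u (k + 2) r * p k r - p (k + 2) r * u k r

/-- The coefficients of the system that variation of parameters gives. -/
noncomputable def parameterCoeff (V : Fin 4 → Fin 4 → ℝ → ℂ) (u p : Fin 4 → ℝ → ℂ) (k l : Fin 4) (r : ℝ) : ℂ :=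
  u (k + 2) r * V k l r * u l r / modeWronskian u p k r

/-- The vector function with parameters `c` in the modes `(u, p)`. -/
def combineModes (u p c : Fin 4 → ℝ → ℂ) (r : ℝ) : Fin 4 → ℂ :=
  ∑ k, c k r • modeVector k (u k r) (p k r)

theorem combineModes_eq (u p c : Fin 4 → ℝ → ℂ) (r : ℝ) :
    combineModes u p c r =
      ![c 0 r * u 0 r + c 2 r * u 2 r, c 0 r * p 0 r + c 2 r * p 2 r,
        c 1 r * u 1 r + c 3 r * u 3 r, c 1 r * p 1 r + c 3 r * p 3 r] := by
  funext i
  fin_cases i <;> simp [combineModes, modeVector, Fin.sum_univ_four]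

/-- The two identities behind variation of parameters. -/
theorem variation_identities {a p b q W : ℂ} (hW : a * q - p * b ≠ 0) (H : ℂ)
    (hWe : W = b * p - q * a) :
    b * H / W * a + a * H / (a * q - p * b) * b = 0 ∧
      b * H / W * p + a * H / (a * q - p * b) * q = H := by
  have h1 : W = -(a * q - p * b) := by rw [hWe]; ring
  rw [h1, div_neg]
  constructor
  · ring
  · rw [show -(b * H / (a * q - p * b)) * p + a * H / (a * q - p * b) * q
      = H * (a * q - p * b) / (a * q - p * b) by ring, mul_div_cancel_right₀ _ hW]

/-- The index `k + 2` is the partner of `k` in its block. The coefficients `c` are chosen so that in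
each block the sum of `c' u` vanishes and the sum of `c' p` equals `H`. The first makes the slope
the derivative of the value; the second replaces each `D` by the true coefficient and adds the
coupling to the other block. Both modes of a block share the same `H`. -/
theorem hasDerivAt_combineModes {w : ℝ → ℝ} {j : ℤ} {m μ : ℝ} {lam : ℂ}
    {u p D c : Fin 4 → ℝ → ℂ} {r : ℝ}
    (hu : ∀ k, HasDerivAt (u k) (p k r) r)
    (hp : ∀ k, HasDerivAt (p k) (D k r * u k r - p k r / r) r)
    (hW : ∀ k, modeWronskian u p k r ≠ 0)
    (hc : ∀ k, HasDerivAt (c k)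
      (∑ l, parameterCoeff (modeResidual w j m μ lam D) u p k l r * c l r) r) :
    HasDerivAt (combineModes u p c) (matB w j m μ lam r *ᵥ combineModes u p c r) r := by
  set H : Fin 4 → ℂ := fun k => ∑ l, modeResidual w j m μ lam D k l r * u l r * c l r with hH
  have hsum : ∀ k, ∑ l, parameterCoeff (modeResidual w j m μ lam D) u p k l r * c l r
      = u (k + 2) r * H k / modeWronskian u p k r := by
    intro k
    simp only [hH, Finset.mul_sum, Finset.sum_div, parameterCoeff]
    exact Finset.sum_congr rfl fun l _ => by ring
  simp only [hsum] at hc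
  have hH02 : H 2 = H 0 := by
    simp [hH, Fin.sum_univ_four, modeResidual, blockExponent, blockAlpha]
  have hH13 : H 3 = H 1 := by
    simp [hH, Fin.sum_univ_four, modeResidual, blockExponent, blockAlpha]
  have hfun : combineModes u p c = fun r =>
      ![c 0 r * u 0 r + c 2 r * u 2 r, c 0 r * p 0 r + c 2 r * p 2 r,
        c 1 r * u 1 r + c 3 r * u 3 r, c 1 r * p 1 r + c 3 r * p 3 r] :=
    funext fun r => combineModes_eq u p c r
  have e0 := hc 0
  have e1 := hc 1
  have e2 := hc 2
  have e3 := hc 3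
  rw [hH02] at e2
  rw [hH13] at e3
  simp only [show (0 : Fin 4) + 2 = 2 from rfl, show (1 : Fin 4) + 2 = 3 from rfl,
    show (2 : Fin 4) + 2 = 0 from rfl, show (3 : Fin 4) + 2 = 1 from rfl] at e0 e1 e2 e3
  obtain ⟨i0, i1⟩ := variation_identities (hW 2) (H 0) (W := modeWronskian u p 0 r) rfl
  obtain ⟨i2, i3⟩ := variation_identities (hW 3) (H 1) (W := modeWronskian u p 1 r) rfl
  change u 2 r * H 0 / modeWronskian u p 0 r * u 0 r
    + u 0 r * H 0 / modeWronskian u p 2 r * u 2 r = 0 at i0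
  change u 2 r * H 0 / modeWronskian u p 0 r * p 0 r
    + u 0 r * H 0 / modeWronskian u p 2 r * p 2 r = H 0 at i1
  change u 3 r * H 1 / modeWronskian u p 1 r * u 1 r
    + u 1 r * H 1 / modeWronskian u p 3 r * u 3 r = 0 at i2
  change u 3 r * H 1 / modeWronskian u p 1 r * p 1 r
    + u 1 r * H 1 / modeWronskian u p 3 r * p 3 r = H 1 at i3
  have hH0 : H 0 = (kPlus j m μ lam r + 4 * ((w r ^ 2 : ℝ) : ℂ) - D 0 r) * u 0 r * c 0 r
      + (kPlus j m μ lam r + 4 * ((w r ^ 2 : ℝ) : ℂ) - D 2 r) * u 2 r * c 2 r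
      + 2 * ((w r ^ 2 : ℝ) : ℂ) * (u 1 r * c 1 r + u 3 r * c 3 r) := by
    simp [hH, Fin.sum_univ_four, modeResidual, blockExponent, blockAlpha, kPlus, alphaPlus]
    ring
  have hH1 : H 1 = (kMinus j m μ lam r + 4 * ((w r ^ 2 : ℝ) : ℂ) - D 1 r) * u 1 r * c 1 r
      + (kMinus j m μ lam r + 4 * ((w r ^ 2 : ℝ) : ℂ) - D 3 r) * u 3 r * c 3 r
      + 2 * ((w r ^ 2 : ℝ) : ℂ) * (u 0 r * c 0 r + u 2 r * c 2 r) := by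
    simp [hH, Fin.sum_univ_four, modeResidual, blockExponent, blockAlpha, kMinus, alphaMinus]
    ring
  have hB : ∀ v : Fin 4 → ℂ, matB w j m μ lam r *ᵥ v =
      ![v 1, (kPlus j m μ lam r + 4 * ((w r ^ 2 : ℝ) : ℂ)) * v 0 - v 1 / r
          + 2 * ((w r ^ 2 : ℝ) : ℂ) * v 2,
        v 3, (kMinus j m μ lam r + 4 * ((w r ^ 2 : ℝ) : ℂ)) * v 2 - v 3 / r
          + 2 * ((w r ^ 2 : ℝ) : ℂ) * v 0] := by
    intro v
    funext i
    fin_cases i <;>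
      simp [matB, matBInf, matBW, Matrix.mulVec, dotProduct, Fin.sum_univ_four, sq_abs] <;> ring
  rw [hB, hfun, hasDerivAt_pi]
  intro i
  fin_cases i
  · refine ((e0.mul (hu 0)).add (e2.mul (hu 2))).congr_deriv ?_
    simp
    linear_combination i0
  · refine ((e0.mul (hp 0)).add (e2.mul (hp 2))).congr_deriv ?_
    simp
    push_cast at hH0
    linear_combination i1 + hH0
  · refine ((e1.mul (hu 1)).add (e3.mul (hu 3))).congr_deriv ?_
    simp
    linear_combination i2
  · refine ((e1.mul (hp 1)).add (e3.mul (hp 3))).congr_deriv ?_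
    simp
    push_cast at hH1
    linear_combination i3 + hH1

theorem continuousOn_parameterCoeff {w : ℝ → ℝ} {j : ℤ} {m μ : ℝ} {lam : ℂ}
    {u p D : Fin 4 → ℝ → ℂ} {S : Set ℝ} (hS : S ⊆ Ioi 0) (hw : ContinuousOn w (Ioi 0))
    (hu : ∀ k, ContinuousOn (u k) S) (hp : ∀ k, ContinuousOn (p k) S)
    (hD : ∀ k, ContinuousOn (D k) S) (hW : ∀ k, ∀ r ∈ S, modeWronskian u p k r ≠ 0)
    (k l : Fin 4) : ContinuousOn (parameterCoeff (modeResidual w j m μ lam D) u p k l) S := by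
  have hw2 : ContinuousOn (fun r => ((w r ^ 2 : ℝ) : ℂ)) S :=
    Complex.continuous_ofReal.comp_continuousOn ((hw.mono hS).pow 2)
  have hV : ContinuousOn (modeResidual w j m μ lam D k l) S := by
    have h1 : ContinuousOn (fun r : ℝ => blockExponent j m k ^ 2 / r ^ 2 + r ^ 2) S :=
      (continuousOn_const.div (by fun_prop) fun r hr => (pow_pos (hS hr) 2).ne').add (by fun_prop)
    unfold modeResidual
    split_ifs
    · exact (((Complex.continuous_ofReal.comp_continuousOn h1).sub continuousOn_const).add
        (continuousOn_const.mul hw2)).sub (hD l)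
    · exact continuousOn_const.mul hw2
  exact (((hu _).mul hV).mul (hu l)).div (((hu _).mul (hp k)).sub ((hp _).mul (hu k))) (hW k)

theorem continuousOn_matB {w : ℝ → ℝ} (hw : ContinuousOn w (Ioi 0)) (j : ℤ) (m μ : ℝ) (lam : ℂ) :
    ContinuousOn (matB w j m μ lam) (Ioi 0) := by
  have hr : ∀ r : ℝ, r ∈ Ioi (0 : ℝ) → r ^ 2 ≠ 0 := fun r hr => (pow_pos hr 2).ne'
  have hr' : ∀ r : ℝ, r ∈ Ioi (0 : ℝ) → (r : ℂ) ≠ 0 := fun r hr =>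
    Complex.ofReal_ne_zero.2 (ne_of_gt hr)
  have h1 : ContinuousOn (kPlus j m μ lam) (Ioi 0) :=
    (Complex.continuous_ofReal.comp_continuousOn (((continuousOn_const.div (by fun_prop) hr).add
      (by fun_prop)).sub continuousOn_const)).sub continuousOn_const
  have h2 : ContinuousOn (kMinus j m μ lam) (Ioi 0) :=
    (Complex.continuous_ofReal.comp_continuousOn (((continuousOn_const.div (by fun_prop) hr).add
      (by fun_prop)).sub continuousOn_const)).add continuousOn_const
  have h3 : ContinuousOn (fun r : ℝ => -1 / (r : ℂ)) (Ioi 0) :=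
    continuousOn_const.div (by fun_prop) hr'
  have h4 : ContinuousOn (fun r => ((|w r| ^ 2 : ℝ) : ℂ)) (Ioi 0) :=
    Complex.continuous_ofReal.comp_continuousOn (hw.abs.pow 2)
  refine ContinuousOn.add ?_ (h4.smul continuousOn_const)
  refine continuousOn_pi.2 fun a => continuousOn_pi.2 fun b => ?_
  fin_cases a <;> fin_cases b <;> simp [matBInf] <;>
    first | exact continuousOn_const | exact h1 | exact h2 | simpa using h3

theorem norm_modeVector_eq (k : Fin 4) (a b : ℂ) : ‖modeVector k a b‖ = max ‖a‖ ‖b‖ := by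
  refine le_antisymm ((pi_norm_le_iff_of_nonneg (by positivity)).2 fun i => ?_) (max_le ?_ ?_)
  · fin_cases k <;> fin_cases i <;> simp [modeVector]
  · fin_cases k
    · exact norm_le_pi_norm (modeVector 0 a b) 0
    · exact norm_le_pi_norm (modeVector 1 a b) 2
    · exact norm_le_pi_norm (modeVector 2 a b) 0
    · exact norm_le_pi_norm (modeVector 3 a b) 2
  · fin_cases k
    · exact norm_le_pi_norm (modeVector 0 a b) 1
    · exact norm_le_pi_norm (modeVector 1 a b) 3
    · exact norm_le_pi_norm (modeVector 2 a b) 1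
    · exact norm_le_pi_norm (modeVector 3 a b) 3

theorem norm_valuePart_modeVector (k : Fin 4) (a b : ℂ) :
    ‖valuePart (modeVector k a b)‖ = ‖a‖ := by
  refine le_antisymm ((pi_norm_le_iff_of_nonneg (norm_nonneg _)).2 fun i => ?_) ?_
  · fin_cases k <;> fin_cases i <;> simp [modeVector, valuePart]
  · fin_cases k
    · exact norm_le_pi_norm (valuePart (modeVector 0 a b)) 0
    · exact norm_le_pi_norm (valuePart (modeVector 1 a b)) 1
    · exact norm_le_pi_norm (valuePart (modeVector 2 a b)) 0
    · exact norm_le_pi_norm (valuePart (modeVector 3 a b)) 1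

theorem valuePart_sub (v v' : Fin 4 → ℂ) : valuePart v - valuePart v' = valuePart (v - v') := by
  funext i
  fin_cases i <;> rfl

theorem valuePart_sum {ι : Type*} (s : Finset ι) (v : ι → Fin 4 → ℂ) :
    valuePart (∑ k ∈ s, v k) = ∑ k ∈ s, valuePart (v k) := by
  funext i
  fin_cases i <;> simp [valuePart]

/-- A combination of modes is asymptotically equivalent to a single mode, if the other terms are
small. -/
theorem asympEquiv_combineModes {l : Filter ℝ} {u p c : Fin 4 → ℝ → ℂ} {b : ℝ → ℂ} (i : Fin 4)
    (h1 : ∀ k, (fun r => (c k r - if k = i then 1 else 0) * u k r) =o[l] u i)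
    (h2 : ∀ k, (fun r => (c k r - if k = i then 1 else 0) * p k r) =o[l]
      fun r => max ‖u i r‖ ‖b r‖)
    (h3 : (fun r => p i r - b r) =o[l] fun r => max ‖u i r‖ ‖b r‖) :
    AsympEquiv l (combineModes u p c) (fun r => modeVector i (u i r) (b r)) := by
  have hdiff : ∀ r, combineModes u p c r - modeVector i (u i r) (b r) =
      (∑ k, modeVector k ((c k r - if k = i then 1 else 0) * u k r)
        ((c k r - if k = i then 1 else 0) * p k r)) + modeVector i 0 (p i r - b r) := by
    intro r
    funext a
    fin_cases i <;> fin_cases a <;>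
      simp [combineModes, modeVector, Fin.sum_univ_four] <;> ring
  have hmax : u i =O[l] fun r => max ‖u i r‖ ‖b r‖ := by
    refine IsBigO.of_bound 1 (Eventually.of_forall fun r => ?_)
    rw [one_mul, Real.norm_of_nonneg (by positivity)]
    exact le_max_left _ _
  have hsmall : ∀ (k : Fin 4) (x z : ℝ → ℂ), x =o[l] u i → z =o[l] (fun r => max ‖u i r‖ ‖b r‖) →
      (fun r => modeVector k (x r) (z r)) =o[l] (fun r => modeVector i (u i r) (b r)) ∧
      (fun r => valuePart (modeVector k (x r) (z r))) =o[l]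
        (fun r => valuePart (modeVector i (u i r) (b r))) := by
    intro k x z hx hz
    constructor
    · rw [← isLittleO_norm_norm]
      simp only [norm_modeVector_eq]
      have hx' := hx.trans_isBigO hmax
      rw [isLittleO_iff] at hx' hz ⊢
      intro ε hε
      filter_upwards [hx' hε, hz hε] with r h4 h5
      rw [Real.norm_of_nonneg (by positivity)]
      exact max_le h4 h5
    · rw [← isLittleO_norm_norm]
      simp only [norm_valuePart_modeVector]
      exact hx.norm_norm
  have h0 : (fun _ : ℝ => (0 : ℂ)) =o[l] u i := isLittleO_zero _ _
  constructor
  · simp only [hdiff]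
    exact (IsLittleO.fun_sum fun k _ => (hsmall k _ _ (h1 k) (h2 k)).1).add (hsmall i _ _ h0 h3).1
  · simp only [valuePart_sub, hdiff]
    have hadd : ∀ v v' : Fin 4 → ℂ, valuePart (v + v') = valuePart v + valuePart v' := by
      intro v v'
      funext i
      fin_cases i <;> rfl
    simp only [hadd, valuePart_sum]
    exact (IsLittleO.fun_sum fun k _ => (hsmall k _ _ (h1 k) (h2 k)).2).add (hsmall i _ _ h0 h3).2

/-! ### Modes and solutions at zero -/

/-- The exponent of the `k`-th solution of the model system at zero. -/
noncomputable def zeroExponent (j : ℤ) (m : ℝ) (k : Fin 4) : ℝ := modeSign k * |blockExponent j m k|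

/-- The value of the `k`-th solution of the model system at zero. -/
noncomputable def zeroValue (j : ℤ) (m : ℝ) (k : Fin 4) (r : ℝ) : ℝ :=
  if modeSign k = -1 ∧ blockExponent j m k = 0 then Real.log r else r ^ zeroExponent j m k

/-- The derivative of the `k`-th solution of the model system at zero. -/
noncomputable def zeroSlope (j : ℤ) (m : ℝ) (k : Fin 4) (r : ℝ) : ℝ :=
  if modeSign k = -1 ∧ blockExponent j m k = 0 then 1 / r
  else r ^ zeroExponent j m k * (zeroExponent j m k / r)

theorem modeSign_cases (k : Fin 4) : modeSign k = 1 ∨ modeSign k = -1 := by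
  fin_cases k <;> simp [modeSign]

theorem modeSign_add_two (k : Fin 4) : modeSign (k + 2) = -modeSign k := by
  fin_cases k <;> simp [modeSign]

theorem blockExponent_add_two (j : ℤ) (m : ℝ) (k : Fin 4) :
    blockExponent j m (k + 2) = blockExponent j m k := by
  fin_cases k <;> simp [blockExponent]

theorem zeroExponent_add_two (j : ℤ) (m : ℝ) (k : Fin 4) :
    zeroExponent j m (k + 2) = -zeroExponent j m k := by
  rw [zeroExponent, zeroExponent, modeSign_add_two, blockExponent_add_two, neg_mul]

theorem zeroExponent_sq (j : ℤ) (m : ℝ) (k : Fin 4) :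
    zeroExponent j m k ^ 2 = blockExponent j m k ^ 2 := by
  rw [zeroExponent, mul_pow, sq_abs]
  rcases modeSign_cases k with h | h <;> rw [h] <;> ring

theorem zeroExponent_eq_zero {j : ℤ} {m : ℝ} {k : Fin 4} (h : blockExponent j m k = 0) :
    zeroExponent j m k = 0 := by
  rw [zeroExponent, h, abs_zero, mul_zero]

theorem leadZero_eq (j : ℤ) (m : ℝ) (k : Fin 4) (r : ℝ) :
    leadZero j m k r = modeVector k (zeroValue j m k r : ℝ) (zeroSlope j m k r : ℝ) := by
  have h : ¬ (1 : ℝ) = -1 := by norm_num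
  fin_cases k
  · simp [leadZero, modeVector, zeroValue, zeroSlope, modeSign, blockExponent, zeroExponent, h]
  · simp [leadZero, modeVector, zeroValue, zeroSlope, modeSign, blockExponent, zeroExponent, h]
  · by_cases h0 : (j : ℝ) + m = 0 <;>
      simp [leadZero, modeVector, zeroValue, zeroSlope, modeSign, blockExponent, zeroExponent, h0]
  · by_cases h0 : (j : ℝ) - m = 0 <;>
      simp [leadZero, modeVector, zeroValue, zeroSlope, modeSign, blockExponent, zeroExponent, h0]

theorem hasDerivAt_zeroValue (j : ℤ) (m : ℝ) (k : Fin 4) {r : ℝ} (hr : 0 < r) :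
    HasDerivAt (zeroValue j m k) (zeroSlope j m k r) r := by
  unfold zeroValue zeroSlope
  split_ifs with h
  · rw [one_div]
    exact Real.hasDerivAt_log hr.ne'
  · refine (Real.hasDerivAt_rpow_const (Or.inl hr.ne')).congr_deriv ?_
    rw [Real.rpow_sub_one hr.ne']
    ring

theorem hasDerivAt_zeroSlope (j : ℤ) (m : ℝ) (k : Fin 4) {r : ℝ} (hr : 0 < r) :
    HasDerivAt (zeroSlope j m k)
      (blockExponent j m k ^ 2 / r ^ 2 * zeroValue j m k r - zeroSlope j m k r / r) r := by
  unfold zeroValue zeroSlope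
  split_ifs with h
  · simp only [one_div]
    refine (hasDerivAt_inv hr.ne').congr_deriv ?_
    rw [h.2]
    field_simp
    ring
  · have h1 : HasDerivAt (fun r : ℝ => zeroExponent j m k / r)
        (zeroExponent j m k * -(r ^ 2)⁻¹) r := (hasDerivAt_inv hr.ne').const_mul _
    refine ((Real.hasDerivAt_rpow_const (Or.inl hr.ne')).fun_mul h1).congr_deriv ?_
    rw [Real.rpow_sub_one hr.ne', ← zeroExponent_sq]
    field_simp
    ring

theorem isSolutionOfSystem_leadZero (j : ℤ) (m : ℝ) (k : Fin 4) :
    IsSolutionOfSystem (matBZero j m) (leadZero j m k) := by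
  intro r hr
  rw [show leadZero j m k = fun r =>
    modeVector k (zeroValue j m k r : ℝ) (zeroSlope j m k r : ℝ) from
    funext fun r => leadZero_eq j m k r]
  have h1 := (hasDerivAt_zeroValue j m k hr).ofReal_comp
  have h2 := (hasDerivAt_zeroSlope j m k hr).ofReal_comp
  rw [hasDerivAt_pi]
  intro a
  fin_cases k <;> fin_cases a <;>
    simp [modeVector, matBZero, Matrix.mulVec, dotProduct, Fin.sum_univ_four, lPlus, lMinus] <;>
    first
    | exact hasDerivAt_const r (0 : ℂ)
    | exact h1
    | (refine h2.congr_deriv ?_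
       simp [blockExponent]
       ring)

/-- By Abel's formula `r` times the Wronskian is constant. The exponent zero needs its own constant,
as there the pair is `1, log r`. -/
theorem modeWronskian_zero (j : ℤ) (m : ℝ) (k : Fin 4) {r : ℝ} (hr : 0 < r) :
    modeWronskian (fun k r => (zeroValue j m k r : ℂ)) (fun k r => (zeroSlope j m k r : ℂ)) k r =
      (((if blockExponent j m k = 0 then -modeSign k else 2 * zeroExponent j m k) / r : ℝ) : ℂ) := by
  simp only [modeWronskian]
  norm_cast
  unfold zeroValue zeroSlope
  rw [modeSign_add_two, blockExponent_add_two, zeroExponent_add_two]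
  by_cases h0 : blockExponent j m k = 0
  · rw [zeroExponent_eq_zero h0]
    rcases modeSign_cases k with h | h
    · have h' : ¬ (1 : ℝ) = -1 := by norm_num
      simp [h, h0, h']
      ring
    · have h' : ¬ (1 : ℝ) = -1 := by norm_num
      simp [h, h0, h']
  · simp only [h0, and_false, if_false]
    have h1 := Real.rpow_pos_of_pos hr (zeroExponent j m k)
    rw [Real.rpow_neg hr.le]
    field_simp
    ring

theorem wronskianCoeff_ne_zero (j : ℤ) (m : ℝ) (k : Fin 4) :
    (if blockExponent j m k = 0 then -modeSign k else 2 * zeroExponent j m k) ≠ 0 := by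
  have h1 : modeSign k ≠ 0 := by rcases modeSign_cases k with h | h <;> rw [h] <;> norm_num
  split_ifs with h
  · exact neg_ne_zero.2 h1
  · exact mul_ne_zero two_ne_zero (mul_ne_zero h1 (abs_ne_zero.2 h))

/-- The factor `r^(-1/4)` absorbs the logarithm, through `log (1/r) ≤ 4 r^(-1/4)`, so that all cases
share one power bound. -/
theorem abs_zeroValue_le (j : ℤ) (m : ℝ) (k : Fin 4) {r : ℝ} (hr : 0 < r) (hr1 : r ≤ 1) :
    |zeroValue j m k r| ≤ 5 * r ^ (-(1 / 4) : ℝ) * r ^ zeroExponent j m k := by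
  have hx : 1 ≤ r ^ (-(1 / 4) : ℝ) := Real.one_le_rpow_of_pos_of_le_one_of_nonpos hr hr1 (by norm_num)
  have hp := Real.rpow_pos_of_pos hr (zeroExponent j m k)
  unfold zeroValue
  split_ifs with h
  · rw [zeroExponent_eq_zero h.2, Real.rpow_zero, mul_one, abs_of_nonpos (Real.log_nonpos hr.le hr1)]
    have h1 := Real.log_le_rpow_div (x := r⁻¹) (ε := 1 / 4) (by positivity) (by norm_num)
    rw [Real.log_inv, Real.inv_rpow hr.le, ← Real.rpow_neg hr.le] at h1
    linarith
  · rw [abs_of_pos hp]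
    nlinarith

/-- The cut-off `exp (-1)` ensures `|log r| ≥ 1`. -/
theorem rpow_le_abs_zeroValue (j : ℤ) (m : ℝ) (k : Fin 4) {r : ℝ} (hr : 0 < r)
    (hr1 : r ≤ Real.exp (-1)) : r ^ zeroExponent j m k ≤ |zeroValue j m k r| := by
  unfold zeroValue
  split_ifs with h
  · have h1 : Real.log r ≤ -1 := (Real.log_le_iff_le_exp hr).2 hr1
    rw [zeroExponent_eq_zero h.2, Real.rpow_zero, abs_of_nonpos (by linarith)]
    linarith
  · exact le_abs_self _

theorem abs_zeroSlope_le (j : ℤ) (m : ℝ) (k : Fin 4) {r : ℝ} (hr : 0 < r) :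
    |zeroSlope j m k r| ≤ (1 + |zeroExponent j m k|) * r ^ (zeroExponent j m k - 1) := by
  rw [Real.rpow_sub_one hr.ne']
  have hp := Real.rpow_pos_of_pos hr (zeroExponent j m k)
  unfold zeroSlope
  split_ifs with h
  · rw [zeroExponent_eq_zero h.2, Real.rpow_zero, abs_zero, abs_of_pos (by positivity)]
    simp
  · rw [abs_mul, abs_div, abs_of_pos hp, abs_of_pos hr]
    have h1 : 0 ≤ r ^ zeroExponent j m k / r := by positivity
    calc _ = |zeroExponent j m k| * (r ^ zeroExponent j m k / r) := by ring
      _ ≤ _ := by gcongr; linarith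

theorem blockExponent_eq_of_same_block {j : ℤ} {m : ℝ} {k l : Fin 4} (h : k = l ∨ k = l + 2) :
    blockExponent j m k = blockExponent j m l := by
  rcases h with rfl | rfl
  · rfl
  · exact blockExponent_add_two j m l

/-- Near zero the full system has a solution with the leading term of each model solution. -/
theorem exists_solution_asympEquiv_leadZero (lam : ℂ) (m μ : ℝ) (j : ℤ) {w : ℝ → ℝ}
    (hw : ContinuousOn w (Ioi 0)) (hb : ∃ C : ℝ, ∀ᶠ r in 𝓝[>] (0 : ℝ), |w r| ≤ C) (i : Fin 4) :
    ∃ y, IsSolutionOfSystem (matB w j m μ lam) y ∧ AsympEquiv (𝓝[>] 0) y (leadZero j m i) := by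
  obtain ⟨C₀, hC₀⟩ := hb
  obtain ⟨r', hr'0, hr'⟩ := mem_nhdsGT_iff_exists_Ioc_subset.1 hC₀
  set r₀ : ℝ := min r' (Real.exp (-1)) with hr₀d
  have hr₀ : 0 < r₀ := lt_min hr'0 (Real.exp_pos _)
  have hexp : Real.exp (-1) ≤ 1 := Real.exp_le_one_iff.2 (by norm_num)
  have hr₁ : r₀ ≤ 1 := (min_le_right _ _).trans hexp
  have hw0 : ∀ r, 0 < r → r ≤ r₀ → |w r| ≤ C₀ := fun r h1 h2 => hr' ⟨h1, h2.trans (min_le_left _ _)⟩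
  have hC₀' : 0 ≤ C₀ := (abs_nonneg _).trans (hw0 r₀ hr₀ le_rfl)
  set σ := zeroExponent j m with hσ
  set u : Fin 4 → ℝ → ℂ := fun k r => (zeroValue j m k r : ℂ) with hu
  set p : Fin 4 → ℝ → ℂ := fun k r => (zeroSlope j m k r : ℂ) with hp
  set D : Fin 4 → ℝ → ℂ := fun k r => ((blockExponent j m k ^ 2 / r ^ 2 : ℝ) : ℂ) with hD
  set ω : Fin 4 → ℝ := fun k =>
    if blockExponent j m k = 0 then -modeSign k else 2 * zeroExponent j m k with hω
  have hω0 : ∀ k, ω k ≠ 0 := wronskianCoeff_ne_zero j m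
  have hW : ∀ k r, 0 < r → modeWronskian u p k r = ((ω k / r : ℝ) : ℂ) := fun k r hr =>
    modeWronskian_zero j m k hr
  have hW0 : ∀ k r, 0 < r → modeWronskian u p k r ≠ 0 := fun k r hr => by
    rw [hW k r hr]
    exact Complex.ofReal_ne_zero.2 (div_ne_zero (hω0 k) hr.ne')
  have hud : ∀ k r, 0 < r → HasDerivAt (u k) (p k r) r := fun k r hr =>
    (hasDerivAt_zeroValue j m k hr).ofReal_comp
  have hpd : ∀ k r, 0 < r → HasDerivAt (p k) (D k r * u k r - p k r / r) r := fun k r hr => by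
    refine (hasDerivAt_zeroSlope j m k hr).ofReal_comp.congr_deriv ?_
    simp only [hD, hu, hp]
    push_cast
    ring
  set V := modeResidual w j m μ lam D with hV
  set K : ℝ := 1 + 2 * ∑ k, ‖blockAlpha μ lam k‖ + 4 * C₀ ^ 2 with hK
  have hK0 : 0 ≤ K := by positivity
  have hVK : ∀ k l r, 0 < r → r ≤ r₀ → ‖V k l r‖ ≤ K := by
    intro k l r h1 h2
    have hw2 : w r ^ 2 ≤ C₀ ^ 2 := by
      rw [← sq_abs]
      exact pow_le_pow_left₀ (abs_nonneg _) (hw0 r h1 h2) 2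
    have hr2 : r ^ 2 ≤ 1 := pow_le_one₀ h1.le (h2.trans hr₁)
    have hα : ‖blockAlpha μ lam k‖ ≤ ∑ k, ‖blockAlpha μ lam k‖ :=
      Finset.single_le_sum (f := fun k => ‖blockAlpha μ lam k‖) (fun _ _ => norm_nonneg _)
        (Finset.mem_univ k)
    have hα0 : 0 ≤ ‖blockAlpha μ lam k‖ := norm_nonneg _
    simp only [hV, modeResidual]
    split_ifs with h
    -- The modes solve the model system exactly, so the singular term `1/r²` cancels and a bounded
    -- residual is left.
    · have h3 : ((blockExponent j m k ^ 2 / r ^ 2 + r ^ 2 : ℝ) : ℂ) - 2 * blockAlpha μ lam k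
          + 4 * ((w r ^ 2 : ℝ) : ℂ) - D l r
          = ((r ^ 2 + 4 * w r ^ 2 : ℝ) : ℂ) - 2 * blockAlpha μ lam k := by
        simp only [hD, blockExponent_eq_of_same_block h]
        push_cast
        ring
      rw [h3]
      refine (norm_sub_le _ _).trans ?_
      rw [Complex.norm_of_nonneg (by positivity), norm_mul, Complex.norm_ofNat]
      linarith
    · rw [norm_mul, Complex.norm_ofNat, Complex.norm_of_nonneg (by positivity)]
      nlinarith [sq_nonneg C₀]
  set Ω : ℝ := ∑ k, |ω k|⁻¹ with hΩ
  have hΩk : ∀ k, |ω k|⁻¹ ≤ Ω := fun k =>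
    Finset.single_le_sum (f := fun k => |ω k|⁻¹) (fun _ _ => by positivity) (Finset.mem_univ k)
  -- The inverse Wronskian contributes a factor `r`, and the two mode bounds cost `r^(-1/4)` each;
  -- this leaves the exponent `1/2`.
  have hQ : ∀ k l r, 0 < r → r ≤ r₀ →
      ‖parameterCoeff V u p k l r‖ ≤ 25 * K * Ω * r ^ (1 / 2 + σ l - σ k) := by
    intro k l r h1 h2
    have hr1 := h2.trans hr₁
    have e1 := abs_zeroValue_le j m (k + 2) h1 hr1
    have e2 := abs_zeroValue_le j m l h1 hr1
    rw [zeroExponent_add_two] at e1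
    have e3 : ‖u (k + 2) r‖ ≤ 5 * r ^ (-(1 / 4) : ℝ) * r ^ (-σ k) := by
      simpa only [hu, Complex.norm_real, Real.norm_eq_abs] using e1
    have e4 : ‖u l r‖ ≤ 5 * r ^ (-(1 / 4) : ℝ) * r ^ σ l := by
      simpa only [hu, Complex.norm_real, Real.norm_eq_abs] using e2
    have hpow : r ^ (1 / 2 + σ l - σ k)
        = r * r ^ (-(1 / 4) : ℝ) * r ^ (-(1 / 4) : ℝ) * r ^ σ l * r ^ (-σ k) := by
      conv_rhs => enter [1, 1, 1, 1]; rw [← Real.rpow_one r]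
      rw [← Real.rpow_add h1, ← Real.rpow_add h1, ← Real.rpow_add h1, ← Real.rpow_add h1]
      congr 1
      ring
    have hWn : ‖modeWronskian u p k r‖ = |ω k| / r := by
      rw [hW k r h1, Complex.norm_real, Real.norm_eq_abs, abs_div, abs_of_pos h1]
    rw [parameterCoeff, norm_div, norm_mul, norm_mul, hWn, hpow]
    calc ‖u (k + 2) r‖ * ‖V k l r‖ * ‖u l r‖ / (|ω k| / r)
        = ‖u (k + 2) r‖ * ‖V k l r‖ * ‖u l r‖ * |ω k|⁻¹ * r := by
          rw [div_div_eq_mul_div]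
          ring
      _ ≤ (5 * r ^ (-(1 / 4) : ℝ) * r ^ (-σ k)) * K * (5 * r ^ (-(1 / 4) : ℝ) * r ^ σ l) * Ω * r := by
          gcongr
          · exact hVK k l r h1 h2
          · exact hΩk k
      _ = _ := by ring
  have hsub : Ioc 0 r₀ ⊆ Ioi (0 : ℝ) := fun r hr => hr.1
  obtain ⟨c, r₁, hr₁0, hci, hck, hcd⟩ := exists_asymptotic_nhdsGT_zero i (σ := σ)
    (Q := parameterCoeff V u p) hr₀ hr₁
    (fun k l => continuousOn_parameterCoeff hsub hw
      (fun k r hr => (hud k r hr.1).continuousAt.continuousWithinAt)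
      (fun k r hr => (hpd k r hr.1).continuousAt.continuousWithinAt)
      (fun k => Complex.continuous_ofReal.comp_continuousOn
        (continuousOn_const.div (by fun_prop) fun r hr => (pow_pos hr.1 2).ne'))
      (fun k r hr => hW0 k r hr.1) k l) hQ
  obtain ⟨y, hy, hyz⟩ := exists_extension_of_hasDerivAt (continuousOn_matB hw j m μ lam)
    (S := Ioo 0 r₁) (z := combineModes u p c) (fun r hr => hr.1) ordConnected_Ioo
    (fun r hr => hasDerivAt_combineModes (fun k => hud k r hr.1) (fun k => hpd k r hr.1)
      (fun k => hW0 k r hr.1) (fun k => hcd k r hr.1 hr.2))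
  refine ⟨y, hy, ?_⟩
  have hev : combineModes u p c =ᶠ[𝓝[>] 0] y := by
    filter_upwards [Ioo_mem_nhdsGT hr₁0] with r hr
    exact (hyz hr).symm
  have hlead : leadZero j m i = fun r => modeVector i (u i r) (p i r) :=
    funext fun r => leadZero_eq j m i r
  have hIoc : ∀ᶠ r in 𝓝[>] (0 : ℝ), 0 < r ∧ r ≤ r₀ := by
    filter_upwards [Ioc_mem_nhdsGT hr₀] with r hr using hr
  have hσu : (fun r : ℝ => r ^ σ i) =O[𝓝[>] 0] u i := by
    refine IsBigO.of_bound 1 ?_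
    filter_upwards [hIoc] with r hr
    rw [one_mul, Real.norm_of_nonneg (Real.rpow_nonneg hr.1.le _)]
    simpa only [hu, Complex.norm_real, Real.norm_eq_abs] using
      rpow_le_abs_zeroValue j m i hr.1 (hr.2.trans (min_le_right _ _))
  have hone : (fun r => c i r - 1) =o[𝓝[>] 0] fun _ => (1 : ℂ) := by
    rw [isLittleO_one_iff]
    simpa using hci.sub_const 1
  -- The extra power of `r` in `hck` is spent here. It is needed for the slopes: they are larger
  -- than the values by `1/r`, while the leading mode may be the constant `1` with slope `0`.
  have hsmall : ∀ k, k ≠ i → ∀ (f : ℝ → ℂ) (A : ℝ), (∀ r, 0 < r → r ≤ r₀ →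
      ‖f r‖ ≤ A * r ^ (σ k - 1)) → (fun r => c k r * f r) =o[𝓝[>] 0] u i := by
    intro k hk f A hf
    refine IsLittleO.trans_isBigO ?_ hσu
    have h1 : (fun r => c k r * (r ^ (σ k - σ i - 1) : ℝ)) =o[𝓝[>] 0] fun _ => (1 : ℝ) :=
      (isLittleO_one_iff ℝ).2 (hck k hk)
    have h2 : (fun r => c k r * f r) =O[𝓝[>] 0]
        fun r => (c k r * (r ^ (σ k - σ i - 1) : ℝ)) * (r ^ σ i : ℝ) := by
      refine IsBigO.of_bound A ?_
      filter_upwards [hIoc] with r hr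
      rw [norm_mul, norm_mul, norm_mul, Complex.norm_of_nonneg (Real.rpow_nonneg hr.1.le _),
        Complex.norm_of_nonneg (Real.rpow_nonneg hr.1.le _), mul_assoc, ← Real.rpow_add hr.1,
        show σ k - σ i - 1 + σ i = σ k - 1 by ring, mul_left_comm]
      exact mul_le_mul_of_nonneg_left (hf r hr.1 hr.2) (norm_nonneg _)
    refine h2.trans_isLittleO ?_
    have h3 := h1.mul_isBigO (isBigO_refl (fun r : ℝ => (((r ^ σ i : ℝ)) : ℂ)) (𝓝[>] 0)).norm_right
    refine h3.trans_isBigO (IsBigO.of_bound 1 (Eventually.of_forall fun r => ?_))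
    simp
  have hmax : ∀ b : ℝ → ℂ, b =O[𝓝[>] 0] (fun r => max ‖u i r‖ ‖b r‖) ∧
      u i =O[𝓝[>] 0] (fun r => max ‖u i r‖ ‖b r‖) := fun b => by
    constructor <;> refine IsBigO.of_bound 1 (Eventually.of_forall fun r => ?_) <;>
      rw [one_mul, Real.norm_of_nonneg (by positivity)]
    · exact le_max_right _ _
    · exact le_max_left _ _
  have hfin : AsympEquiv (𝓝[>] 0) (combineModes u p c) (leadZero j m i) := by
    rw [hlead]
    refine asympEquiv_combineModes i (fun k => ?_) (fun k => ?_) ?_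
    · by_cases hk : k = i
      · subst hk
        simpa using hone.mul_isBigO (isBigO_refl (u k) (𝓝[>] 0))
      · simp only [if_neg hk, sub_zero]
        refine hsmall k hk (u k) 5 fun r h1 h2 => ?_
        have e := abs_zeroValue_le j m k h1 (h2.trans hr₁)
        simp only [hu, Complex.norm_real, Real.norm_eq_abs]
        refine e.trans ?_
        rw [mul_assoc, ← Real.rpow_add h1]
        refine mul_le_mul_of_nonneg_left ?_ (by norm_num)
        exact Real.rpow_le_rpow_of_exponent_ge h1 (h2.trans hr₁) (by linarith)
    · by_cases hk : k = i
      · subst hk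
        refine IsLittleO.trans_isBigO ?_ (hmax (p k)).1
        simpa using hone.mul_isBigO (isBigO_refl (p k) (𝓝[>] 0))
      · simp only [if_neg hk, sub_zero]
        refine (hsmall k hk (p k) (1 + |σ k|) fun r h1 h2 => ?_).trans_isBigO (hmax (p i)).2
        simpa only [hp, Complex.norm_real, Real.norm_eq_abs] using abs_zeroSlope_le j m k h1
    · simp only [sub_self]
      exact isLittleO_zero _ _
  constructor
  · exact hfin.1.congr' (hev.fun_comp (fun v => v) |>.sub (EventuallyEq.refl _ _)) EventuallyEq.rfl
  · refine hfin.2.congr' ?_ EventuallyEq.rfl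
    filter_upwards [hev] with r hr
    rw [hr]

/-- Evaluation at `r = 1` suffices: all powers equal `1` there, and the logarithm vanishes with
slope `1`. The blocks separate into invertible two-by-two systems. -/
theorem linearIndependent_leadZero (j : ℤ) (m : ℝ) :
    LinearIndependent ℂ (fun i => (Ioi (0 : ℝ)).domRestrict (leadZero j m i)) := by
  rw [Fintype.linearIndependent_iff]
  intro a ha
  have h1 : ∑ k, a k • leadZero j m k 1 = 0 := by
    have := congrFun ha ⟨1, mem_Ioi.2 one_pos⟩
    simpa [Finset.sum_apply] using this
  have e0 := congrFun h1 0
  have e1 := congrFun h1 1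
  have e2 := congrFun h1 2
  have e3 := congrFun h1 3
  have hpair : ∀ (x y : ℂ) (t : ℝ), t ≠ 0 → x + y = 0 → x * (|t| : ℝ) + -(y * (|t| : ℝ)) = 0 →
      x = 0 ∧ y = 0 := by
    intro x y t ht h2 h3
    have h4 : ((|t| : ℝ) : ℂ) ≠ 0 := Complex.ofReal_ne_zero.2 (abs_ne_zero.2 ht)
    have hy : y = -x := by linear_combination h2
    subst hy
    have h5 : x * (2 * ((|t| : ℝ) : ℂ)) = 0 := by linear_combination h3
    have h6 : x = 0 := (mul_eq_zero.1 h5).resolve_right (mul_ne_zero two_ne_zero h4)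
    simp [h6]
  have h0123 : (a 0 = 0 ∧ a 2 = 0) ∧ (a 1 = 0 ∧ a 3 = 0) := by
    by_cases hp : (j : ℝ) + m = 0 <;> by_cases hq : (j : ℝ) - m = 0 <;>
      simp [Fin.sum_univ_four, leadZero, hp, hq] at e0 e1 e2 e3
    · exact ⟨⟨e0, e1⟩, e2, e3⟩
    · exact ⟨⟨e0, e1⟩, hpair _ _ _ hq e2 e3⟩
    · exact ⟨hpair _ _ _ hp e0 e1, e2, e3⟩
    · exact ⟨hpair _ _ _ hp e0 e1, hpair _ _ _ hq e2 e3⟩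
  intro i
  fin_cases i
  · exact h0123.1.1
  · exact h0123.2.1
  · exact h0123.1.2
  · exact h0123.2.2

/-! ### Decay of the vortex profile -/

theorem IsVortexProfile.continuousOn {m μ : ℝ} {w : ℝ → ℝ} (hw : IsVortexProfile m μ w) :
    ContinuousOn w (Ioi 0) := hw.contDiffOn.continuousOn

/-- With the zero profile the full system becomes the model system at infinity. -/
theorem IsVortexProfile.zero (m μ : ℝ) : IsVortexProfile m μ fun _ => 0 where
  contDiffOn := contDiffOn_const
  equation := fun r _ => by simp
  nonneg := fun _ _ => le_rfl
  bounded_zero := ⟨0, by simp⟩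
  tendsto_zero := tendsto_const_nhds

/-- A strict local minimum in the sense of the second derivative is not a local maximum. -/
theorem not_isLocalMax_of_deriv_deriv_pos {f : ℝ → ℝ} {x : ℝ} (hf : 0 < deriv (deriv f) x)
    (hc : ContinuousAt f x) : ¬ IsLocalMax f x := by
  intro hmax
  have hmin := isLocalMin_of_deriv_deriv_pos hf hmax.deriv_eq_zero hc
  have h1 : f =ᶠ[𝓝 x] fun _ => f x := by
    filter_upwards [hmax, hmin] with y h2 h3
    exact le_antisymm h2 h3
  have h2 : deriv f =ᶠ[𝓝 x] fun _ => 0 := by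
    filter_upwards [h1.eventuallyEq_nhds] with y hy
    rw [hy.deriv_eq, deriv_const]
  rw [h2.deriv_eq, deriv_const] at hf
  exact lt_irrefl _ hf

/-- A vortex profile is `O(1/r)` at infinity, by comparison with multiples of `1/r`. -/
theorem IsVortexProfile.exists_le_div {m μ : ℝ} {w : ℝ → ℝ} (hw : IsVortexProfile m μ w) :
    ∃ C : ℝ, ∀ᶠ r in atTop, w r ≤ C / r := by
  -- This choice gives `r² - 2μ ≥ 2` for `r ≥ R`, and `C` below makes `w - C / r` vanish at `R`.
  set R : ℝ := 2 + 2 * |μ| with hR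
  have hR2 : 2 ≤ R := by have := abs_nonneg μ; linarith
  have hR0 : 0 < R := by linarith
  set C : ℝ := R * w R with hC
  have hC0 : 0 ≤ C := mul_nonneg hR0.le (hw.nonneg R hR0)
  set φ : ℝ → ℝ := fun r => w r - C / r with hφ
  have hφR : φ R = 0 := by
    simp only [hφ, hC]
    field_simp
    ring
  have hφlim : Tendsto φ atTop (𝓝 0) := by
    have h1 : Tendsto (fun r : ℝ => C / r) atTop (𝓝 0) := tendsto_const_nhds.div_atTop tendsto_id
    simpa using hw.tendsto_zero.sub h1
  have hφc : ContinuousOn φ (Ioi 0) :=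
    hw.continuousOn.sub (continuousOn_const.div continuousOn_id fun r hr => ne_of_gt hr)
  have hw1 : ∀ r, 0 < r → DifferentiableAt ℝ w r := fun r hr =>
    (hw.contDiffOn.contDiffAt (Ioi_mem_nhds hr)).differentiableAt (by norm_num)
  have hw2 : ∀ r, 0 < r → DifferentiableAt ℝ (deriv w) r := fun r hr =>
    ((hw.contDiffOn.deriv_of_isOpen (m := 1) isOpen_Ioi (by norm_num)).contDiffAt
      (Ioi_mem_nhds hr)).differentiableAt (by norm_num)
  have hφ1 : ∀ r, 0 < r → HasDerivAt φ (deriv w r + C * (r ^ 2)⁻¹) r := fun r hr => by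
    have h1 := (hw1 r hr).hasDerivAt.fun_sub ((hasDerivAt_inv hr.ne').const_mul C)
    simp only [← div_eq_mul_inv] at h1
    refine h1.congr_deriv ?_
    rw [mul_neg, sub_neg_eq_add]
  have hφ2 : ∀ r, 0 < r → deriv (deriv φ) r = deriv (deriv w) r - 2 * C / r ^ 3 := fun r hr => by
    have h1 : deriv φ =ᶠ[𝓝 r] fun r => deriv w r + C * (r ^ 2)⁻¹ := by
      filter_upwards [Ioi_mem_nhds hr] with s hs
      exact (hφ1 s hs).deriv
    rw [h1.deriv_eq]
    have h2 : HasDerivAt (fun r : ℝ => r ^ 2) (2 * r) r := by simpa using hasDerivAt_pow 2 r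
    have h3 := (hw2 r hr).hasDerivAt.fun_add ((h2.fun_inv (pow_pos hr 2).ne').const_mul C)
    rw [h3.deriv]
    field_simp
    ring
  have key : ∀ r, R ≤ r → φ r ≤ 0 := by
    intro r₁ hr₁
    by_contra! hpos
    obtain ⟨R₂, hR₂, hR₂'⟩ := ((hφlim.eventually (gt_mem_nhds hpos)).and
      (eventually_gt_atTop r₁)).exists
    obtain ⟨r₀, hr₀, hmax⟩ := (isCompact_Icc (a := R) (b := R₂)).exists_isMaxOn
      ⟨r₁, hr₁, hR₂'.le⟩ (hφc.mono fun r hr => hR0.trans_le hr.1)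
    have h1 : φ r₁ ≤ φ r₀ := hmax ⟨hr₁, hR₂'.le⟩
    have hne1 : r₀ ≠ R := fun h => by rw [h, hφR] at h1; linarith
    have hne2 : r₀ ≠ R₂ := fun h => by rw [h] at h1; linarith
    have hmem : Icc R R₂ ∈ 𝓝 r₀ :=
      Icc_mem_nhds (lt_of_le_of_ne hr₀.1 hne1.symm) (lt_of_le_of_ne hr₀.2 hne2)
    have hloc : IsLocalMax φ r₀ := hmax.isLocalMax hmem
    have hr0 : 0 < r₀ := hR0.trans_le hr₀.1
    -- At a positive interior maximum `w' = -C/r²` and `w > C/r`. The equation then gives `φ'' ≥ 2w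
    -- - C/r³`, which is positive because `C/r³ ≤ C/r < w`.
    refine not_isLocalMax_of_deriv_deriv_pos ?_ (hφ1 r₀ hr0).continuousAt hloc
    have hd0 : deriv w r₀ = -(C * (r₀ ^ 2)⁻¹) := by
      have h2 := hloc.deriv_eq_zero
      rw [(hφ1 r₀ hr0).deriv] at h2
      linarith
    have hwr : C / r₀ < w r₀ := by
      have : 0 < w r₀ - C / r₀ := lt_of_lt_of_le hpos h1
      linarith
    have hwpos : 0 < w r₀ := lt_of_le_of_lt (by positivity) hwr
    have heq := hw.equation r₀ hr0
    rw [hφ2 r₀ hr0]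
    have h3 : 1 / r₀ * deriv w r₀ = -(C / r₀ ^ 3) := by
      rw [hd0]
      field_simp
    have h4 : 0 ≤ m ^ 2 / r₀ ^ 2 * w r₀ := by positivity
    have h5 : 0 ≤ 2 * |w r₀| ^ 2 * w r₀ := by positivity
    have h6 : 2 * w r₀ ≤ (r₀ ^ 2 - 2 * μ) * w r₀ := by
      refine mul_le_mul_of_nonneg_right ?_ hwpos.le
      have h7 : R ≤ r₀ := hr₀.1
      have h8 := le_abs_self μ
      nlinarith
    have h7 : C / r₀ ^ 3 ≤ C / r₀ := by
      refine div_le_div_of_nonneg_left hC0 hr0 ?_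
      exact le_self_pow₀ (by linarith [hr₀.1]) (by norm_num)
    have h8 : 2 * C / r₀ ^ 3 = 2 * (C / r₀ ^ 3) := by ring
    rw [h8]
    nlinarith
  refine ⟨C, ?_⟩
  filter_upwards [eventually_ge_atTop R] with r hr
  have := key r hr
  simp only [hφ] at this
  linarith

/-! ### Modes and solutions at infinity -/

/-- The quadratic term dominates: for `1 ≤ s ≤ t` one has `log t - log s ≤ t - s`, and `|q| ≤ a * s`
once `s` is large. -/
theorem monotoneOn_tendsto_sq_add_log {a q : ℝ} (h : 0 < a ∨ a = 0 ∧ 0 < q) :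
    (∀ᶠ T in atTop, MonotoneOn (fun r => a * r ^ 2 + q * Real.log r) (Ici T)) ∧
      Tendsto (fun r => a * r ^ 2 + q * Real.log r) atTop atTop := by
  rcases h with ha | ⟨rfl, hq⟩
  · constructor
    · filter_upwards [eventually_ge_atTop 1, eventually_ge_atTop (|q| / a)] with T hT1 hTq
      intro s hs t ht hst
      have hs' : T ≤ s := hs
      have hs1 : 1 ≤ s := hT1.trans hs'
      have hs0 : 0 < s := by linarith
      have ht0 : 0 < t := by linarith
      have hlog0 : 0 ≤ Real.log t - Real.log s := sub_nonneg.2 (Real.log_le_log hs0 hst)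
      have hlog : Real.log t - Real.log s ≤ t - s := by
        rw [← Real.log_div ht0.ne' hs0.ne']
        refine (Real.log_le_sub_one_of_pos (by positivity)).trans ?_
        rw [div_sub_one hs0.ne']
        exact div_le_self (by linarith) hs1
      have hq : |q| ≤ a * s := by
        rw [div_le_iff₀ ha] at hTq
        nlinarith
      have h1 : -(|q| * (t - s)) ≤ q * (Real.log t - Real.log s) := by
        have h2 := neg_abs_le q
        nlinarith [abs_nonneg q]
      have h3 : |q| * (t - s) ≤ a * s * (t - s) :=
        mul_le_mul_of_nonneg_right hq (by linarith)
      have h4 : a * s * (t - s) ≤ a * (t + s) * (t - s) := by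
        have : 0 ≤ a * t * (t - s) := mul_nonneg (by positivity) (by linarith)
        nlinarith
      simp only
      nlinarith
    · have h1 : Tendsto (fun r : ℝ => r * (a * r - |q|)) atTop atTop :=
        tendsto_id.atTop_mul_atTop₀ (tendsto_atTop_add_const_right _ _ (tendsto_id.const_mul_atTop ha))
      refine tendsto_atTop_mono' _ ?_ h1
      filter_upwards [eventually_ge_atTop 1] with r hr
      have h2 : 0 ≤ Real.log r := Real.log_nonneg hr
      have h3 : Real.log r ≤ r := Real.log_le_self (by linarith)
      have h4 := neg_abs_le q
      nlinarith [abs_nonneg q]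
  · constructor
    · filter_upwards [eventually_gt_atTop 0] with T hT
      intro s hs t ht hst
      have hs' : T ≤ s := hs
      have := Real.log_le_log (by linarith) hst
      simp only
      nlinarith
    · simpa using Real.tendsto_log_atTop.const_mul_atTop hq

/-- Quotients of mode sizes have this form. The lexicographic sign of `(a, q)` decides between
growth and decay; the constant quotient counts as monotone, so it is integrated from infinity. -/
theorem exp_sq_add_log_dichotomy (a q : ℝ) : ∀ᶠ T in atTop,
    (AntitoneOn (fun r => Real.exp (a * r ^ 2 + q * Real.log r)) (Ici T) ∧
      Tendsto (fun r => Real.exp (a * r ^ 2 + q * Real.log r)) atTop (𝓝 0)) ∨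
    MonotoneOn (fun r => Real.exp (a * r ^ 2 + q * Real.log r)) (Ici T) := by
  by_cases h : 0 < a ∨ a = 0 ∧ 0 < q
  · filter_upwards [(monotoneOn_tendsto_sq_add_log h).1] with T hT
    exact Or.inr (Real.exp_monotone.comp_monotoneOn hT)
  by_cases h' : 0 < -a ∨ -a = 0 ∧ 0 < -q
  · obtain ⟨h1, h2⟩ := monotoneOn_tendsto_sq_add_log h'
    have h3 : ∀ r : ℝ, a * r ^ 2 + q * Real.log r = -(-a * r ^ 2 + -q * Real.log r) := fun r => by
      ring
    filter_upwards [h1] with T hT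
    refine Or.inl ⟨fun s hs t ht hst => ?_, ?_⟩
    · refine Real.exp_monotone ?_
      rw [h3, h3 s]
      exact neg_le_neg (hT hs ht hst)
    · simp only [h3]
      exact Real.tendsto_exp_neg_atTop_nhds_zero.comp h2
  · have ha : a = 0 := by
      push Not at h h'
      linarith [h.1, h'.1]
    have hq : q = 0 := by
      subst ha
      simp only [lt_self_iff_false, true_and, false_or, neg_zero, not_lt] at h h'
      linarith
    refine Eventually.of_forall fun T => Or.inr ?_
    simp only [ha, hq]
    intro s _ t _ _
    simp

theorem blockAlpha_add_two (μ : ℝ) (lam : ℂ) (k : Fin 4) :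
    blockAlpha μ lam (k + 2) = blockAlpha μ lam k := by
  fin_cases k <;> simp [blockAlpha]

/-- The exponent of the power in the `k`-th approximate solution at infinity. -/
noncomputable def infExponent (μ : ℝ) (lam : ℂ) (k : Fin 4) : ℂ :=
  -(modeSign k : ℂ) * blockAlpha μ lam k - 1

/-- The value of the `k`-th approximate solution at infinity. -/
noncomputable def infValue (μ : ℝ) (lam : ℂ) (k : Fin 4) (r : ℝ) : ℂ :=
  Complex.exp ((modeSign k * (r ^ 2 / 2) : ℝ) + infExponent μ lam k * (Real.log r : ℝ))

/-- The derivative of the `k`-th approximate solution at infinity. -/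
noncomputable def infSlope (μ : ℝ) (lam : ℂ) (k : Fin 4) (r : ℝ) : ℂ :=
  infValue μ lam k r * (modeSign k * r + infExponent μ lam k * (r : ℂ)⁻¹)

theorem infValue_ne_zero (μ : ℝ) (lam : ℂ) (k : Fin 4) (r : ℝ) : infValue μ lam k r ≠ 0 :=
  Complex.exp_ne_zero _

theorem norm_infValue (μ : ℝ) (lam : ℂ) (k : Fin 4) (r : ℝ) : ‖infValue μ lam k r‖ =
    Real.exp (modeSign k * (r ^ 2 / 2) + (infExponent μ lam k).re * Real.log r) := by
  rw [infValue, Complex.norm_exp]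
  simp only [Complex.add_re, Complex.ofReal_re, Complex.re_mul_ofReal]

theorem infValue_eq (μ : ℝ) (lam : ℂ) (k : Fin 4) {r : ℝ} (hr : 0 < r) : infValue μ lam k r =
    (Real.exp (modeSign k * (r ^ 2 / 2)) : ℝ) * (r : ℂ) ^ (-(modeSign k : ℂ) * blockAlpha μ lam k)
      * (1 / r) := by
  have hrc : (r : ℂ) ≠ 0 := Complex.ofReal_ne_zero.2 hr.ne'
  rw [infValue, Complex.exp_add, ← Complex.ofReal_exp, Complex.ofReal_log hr.le, mul_assoc]
  congr 1
  rw [mul_comm, ← Complex.cpow_def_of_ne_zero hrc, infExponent, Complex.cpow_sub _ _ hrc,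
    Complex.cpow_one, mul_one_div]

theorem leadInf_eq (μ : ℝ) (lam : ℂ) (k : Fin 4) {r : ℝ} (hr : 0 < r) : leadInf μ lam k r =
    modeVector k (infValue μ lam k r) (modeSign k * r * infValue μ lam k r) := by
  have hrc : (r : ℂ) ≠ 0 := Complex.ofReal_ne_zero.2 hr.ne'
  rw [infValue_eq μ lam k hr]
  funext a
  fin_cases k <;> fin_cases a <;>
    simp [leadInf, modeVector, modeSign, blockAlpha, neg_div] <;> field_simp

theorem hasDerivAt_infValue (μ : ℝ) (lam : ℂ) (k : Fin 4) {r : ℝ} (hr : 0 < r) :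
    HasDerivAt (infValue μ lam k) (infSlope μ lam k r) r := by
  have h1 : HasDerivAt (fun r : ℝ => modeSign k * (r ^ 2 / 2)) (modeSign k * r) r := by
    refine (((hasDerivAt_pow 2 r).div_const 2).const_mul (modeSign k)).congr_deriv ?_
    simp
  have h2 := h1.ofReal_comp.fun_add
    ((Real.hasDerivAt_log hr.ne').ofReal_comp.const_mul (infExponent μ lam k))
  refine h2.cexp.congr_deriv ?_
  simp only [infSlope, infValue]
  push_cast
  rfl

/-- For `u = exp (s r²/2) * r^β` with `s² = 1`, the quotient `(u'' + u'/r) / u` is `r² + 2s(β + 1) +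
β²/r²`. The exponent `β = -sα - 1` turns the middle term into `-2α`, and only `β²/r²` is in excess.
-/
theorem hasDerivAt_infSlope (μ : ℝ) (lam : ℂ) (k : Fin 4) {r : ℝ} (hr : 0 < r) :
    HasDerivAt (infSlope μ lam k)
      (((r : ℂ) ^ 2 - 2 * blockAlpha μ lam k + infExponent μ lam k ^ 2 / (r : ℂ) ^ 2)
        * infValue μ lam k r - infSlope μ lam k r / r) r := by
  have hrc : (r : ℂ) ≠ 0 := Complex.ofReal_ne_zero.2 hr.ne'
  have h1 : HasDerivAt (fun r : ℝ => (r : ℂ)) 1 r := Complex.ofRealCLM.hasDerivAt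
  have h2 := (h1.const_mul (modeSign k : ℂ)).fun_add
    ((h1.fun_inv hrc).const_mul (infExponent μ lam k))
  refine ((hasDerivAt_infValue μ lam k hr).fun_mul h2).congr_deriv ?_
  have hs : (modeSign k : ℂ) ^ 2 = 1 := by
    rcases modeSign_cases k with h | h <;> rw [h] <;> norm_num
  have hα : infExponent μ lam k * modeSign k + modeSign k + blockAlpha μ lam k = 0 := by
    rw [infExponent]
    linear_combination (-blockAlpha μ lam k) * hs
  simp only [infSlope]
  field_simp
  linear_combination (infValue μ lam k r * r ^ 4) * hs + 2 * infValue μ lam k r * r ^ 2 * hα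

theorem modeWronskian_inf (μ : ℝ) (lam : ℂ) (k : Fin 4) {r : ℝ} (hr : 0 < r) :
    modeWronskian (infValue μ lam) (infSlope μ lam) k r =
      infValue μ lam (k + 2) r * infValue μ lam k r *
        (2 * modeSign k * (r - blockAlpha μ lam k / r)) := by
  have hrc : (r : ℂ) ≠ 0 := Complex.ofReal_ne_zero.2 hr.ne'
  simp only [modeWronskian, infSlope, infExponent, modeSign_add_two, blockAlpha_add_two]
  push_cast
  field_simp
  ring

/-- Near infinity the full system has a solution with each of the leading terms. -/
theorem exists_solution_asympEquiv_leadInf (lam : ℂ) (m μ : ℝ) (j : ℤ) {w : ℝ → ℝ}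
    (hw : ContinuousOn w (Ioi 0)) (hb : ∃ C : ℝ, ∀ᶠ r in atTop, w r ^ 2 ≤ C / r) (i : Fin 4) :
    ∃ y, IsSolutionOfSystem (matB w j m μ lam) y ∧ AsympEquiv atTop y (leadInf μ lam i) := by
  obtain ⟨C₀, hC₀⟩ := hb
  set u := infValue μ lam with hu
  set p := infSlope μ lam with hp
  set β := infExponent μ lam with hβ
  set α := blockAlpha μ lam with hα
  set D : Fin 4 → ℝ → ℂ := fun k r => (r : ℂ) ^ 2 - 2 * α k + β k ^ 2 / (r : ℂ) ^ 2 with hD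
  set V := modeResidual w j m μ lam D with hV
  set A : ℝ := ∑ k, ‖α k‖ with hA
  have hαA : ∀ k, ‖α k‖ ≤ A := fun k =>
    Finset.single_le_sum (f := fun k => ‖α k‖) (fun _ _ => norm_nonneg _) (Finset.mem_univ k)
  set N : ℝ := ∑ k, (blockExponent j m k ^ 2 + ‖β k‖ ^ 2) with hN
  have hνN : ∀ k, blockExponent j m k ^ 2 + ‖β k‖ ^ 2 ≤ N := fun k =>
    Finset.single_le_sum (f := fun k => blockExponent j m k ^ 2 + ‖β k‖ ^ 2)
      (fun _ _ => by positivity) (Finset.mem_univ k)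
  have hN0 : 0 ≤ N := by positivity
  -- The condition `2 * A ≤ T` gives `|α / r| ≤ r / 2`, which keeps the factor `2 (r - α / r)` of
  -- the Wronskian at least `r` in norm.
  obtain ⟨T, hT1, hTA, hTw, hTm⟩ : ∃ T : ℝ, 1 ≤ T ∧ 2 * A ≤ T ∧ (∀ r, T ≤ r → w r ^ 2 ≤ C₀ / r) ∧
      ∀ k, (AntitoneOn (fun t => ‖u k t‖ / ‖u i t‖) (Ici T) ∧
        Tendsto (fun t => ‖u k t‖ / ‖u i t‖) atTop (𝓝 0)) ∨
        MonotoneOn (fun t => ‖u k t‖ / ‖u i t‖) (Ici T) := by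
    have hq : ∀ k t, ‖u k t‖ / ‖u i t‖ = Real.exp ((modeSign k - modeSign i) / 2 * t ^ 2
        + ((β k).re - (β i).re) * Real.log t) := fun k t => by
      rw [hu, norm_infValue, norm_infValue, ← Real.exp_sub]
      congr 1
      ring
    simp only [hq]
    exact ((eventually_ge_atTop 1).and ((eventually_ge_atTop (2 * A)).and
      ((eventually_forall_ge_atTop.2 hC₀).and
        (eventually_all.2 fun k => exp_sq_add_log_dichotomy _ _)))).exists
  have hpos : ∀ r, T ≤ r → 0 < r := fun r hr => by linarith
  have hC0 : 0 ≤ C₀ := by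
    have h1 := (sq_nonneg (w T)).trans (hTw T le_rfl)
    have h2 := hpos T le_rfl
    simpa [h2.ne'] using mul_nonneg h1 h2.le
  have hX : ∀ k r, T ≤ r → r ≤ ‖2 * (modeSign k : ℂ) * (r - α k / r)‖ := by
    intro k r hr
    have hr0 := hpos r hr
    have h1 : ‖(modeSign k : ℂ)‖ = 1 := by
      rcases modeSign_cases k with h | h <;> rw [h] <;> norm_num
    have h2 : ‖α k / r‖ ≤ r / 2 := by
      rw [norm_div, Complex.norm_of_nonneg hr0.le]
      refine (div_le_self (norm_nonneg _) (by linarith)).trans ?_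
      linarith [hαA k]
    have h3 := norm_sub_norm_le (r : ℂ) (α k / r)
    rw [Complex.norm_of_nonneg hr0.le] at h3
    rw [norm_mul, norm_mul, h1, Complex.norm_ofNat]
    linarith
  have hu0 : ∀ k r, u k r ≠ 0 := infValue_ne_zero μ lam
  have hun : ∀ k r, 0 < ‖u k r‖ := fun k r => norm_pos_iff.2 (hu0 k r)
  have hW : ∀ k r, T ≤ r → modeWronskian u p k r =
      u (k + 2) r * u k r * (2 * modeSign k * (r - α k / r)) := fun k r hr =>
    modeWronskian_inf μ lam k (hpos r hr)
  have hW0 : ∀ k r, T ≤ r → modeWronskian u p k r ≠ 0 := fun k r hr => by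
    rw [hW k r hr]
    refine mul_ne_zero (mul_ne_zero (hu0 _ _) (hu0 _ _)) (norm_pos_iff.1 ?_)
    exact (hpos r hr).trans_le (hX k r hr)
  have hud : ∀ k r, T ≤ r → HasDerivAt (u k) (p k r) r := fun k r hr =>
    hasDerivAt_infValue μ lam k (hpos r hr)
  have hpd : ∀ k r, T ≤ r → HasDerivAt (p k) (D k r * u k r - p k r / r) r := fun k r hr =>
    hasDerivAt_infSlope μ lam k (hpos r hr)
  set K : ℝ := N + 4 * C₀ with hK
  have hVK : ∀ k l r, T ≤ r → ‖V k l r‖ ≤ K / r := by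
    intro k l r hr
    have hr0 := hpos r hr
    have hw2 := hTw r hr
    simp only [hV, modeResidual]
    split_ifs with h
    · have hαkl : α k = α l := by
        rcases h with rfl | rfl
        · rfl
        · exact blockAlpha_add_two μ lam l
      have h3 : ((blockExponent j m k ^ 2 / r ^ 2 + r ^ 2 : ℝ) : ℂ) - 2 * α k
          + 4 * ((w r ^ 2 : ℝ) : ℂ) - D l r
          = ((blockExponent j m l ^ 2 / r ^ 2 + 4 * w r ^ 2 : ℝ) : ℂ) - β l ^ 2 / (r : ℂ) ^ 2 := by
        simp only [hD, blockExponent_eq_of_same_block h, hαkl]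
        push_cast
        ring
      rw [h3]
      refine (norm_sub_le _ _).trans ?_
      rw [Complex.norm_of_nonneg (by positivity), norm_div, norm_pow, norm_pow,
        Complex.norm_of_nonneg hr0.le]
      have h4 : (blockExponent j m l ^ 2 + ‖β l‖ ^ 2) / r ^ 2 ≤ N / r := by
        refine div_le_div₀ hN0 (hνN l) hr0 ?_
        exact le_self_pow₀ (by linarith) (by norm_num)
      rw [add_div] at h4
      rw [hK, add_div, mul_div_assoc]
      linarith
    · rw [norm_mul, Complex.norm_ofNat, Complex.norm_of_nonneg (by positivity), hK, add_div,
        mul_div_assoc]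
      have h5 : 0 ≤ N / r := by positivity
      have h6 : 0 ≤ C₀ / r := by positivity
      linarith
  have hsub : Ici T ⊆ Ioi (0 : ℝ) := fun r hr => hpos r hr
  -- In `ρ = K r⁻²` one factor `1/r` comes from the residual and the other from the Wronskian.
  obtain ⟨c, T', hT', hc, hcd⟩ := exists_asymptotic_atTop i (g := fun k r => ‖u k r‖)
    (Q := parameterCoeff V u p) (ρ := fun r => K * r ^ (-2 : ℝ)) (T := T)
    (fun k r hr => (hud k r hr).continuousAt.continuousWithinAt.norm)
    (fun k r _ => hun k r) hTm
    (fun k l => continuousOn_parameterCoeff hsub hw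
      (fun k r hr => (hud k r hr).continuousAt.continuousWithinAt)
      (fun k r hr => (hpd k r hr).continuousAt.continuousWithinAt)
      (fun k => ((by fun_prop : ContinuousOn (fun r : ℝ => (r : ℂ) ^ 2 - 2 * α k) (Ici T)).add
        (continuousOn_const.div (by fun_prop) fun r hr =>
          pow_ne_zero 2 (Complex.ofReal_ne_zero.2 (hpos r hr).ne'))))
      (fun k r hr => hW0 k r hr) k l)
    (fun k l r hr => by
      have hr0 := hpos r hr
      have h1 := hun (k + 2) r
      have h2 := hun k r
      have h3 := hX k r hr
      have h4 : 0 < ‖2 * (modeSign k : ℂ) * (r - α k / r)‖ := hr0.trans_le h3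
      rw [parameterCoeff, hW k r hr, norm_div, norm_mul, norm_mul, norm_mul (u (k + 2) r * u k r),
        norm_mul (u (k + 2) r)]
      calc _ = ‖V k l r‖ / ‖2 * (modeSign k : ℂ) * (r - α k / r)‖ * ‖u l r‖ := by field_simp
        _ ≤ (K / r) / r * ‖u l r‖ := by
          refine mul_le_mul_of_nonneg_right ?_ (norm_nonneg _)
          exact div_le_div₀ (by positivity) (hVK k l r hr) hr0 h3
        _ = _ := by
          rw [Real.rpow_neg hr0.le, Real.rpow_two]
          field_simp)
    ((integrableOn_Ioi_rpow_of_lt (by norm_num) (hpos T le_rfl)).const_mul K)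
  have hpos' : ∀ r, T' < r → 0 < r := fun r hr => hpos r (hT'.trans hr.le)
  obtain ⟨y, hy, hyz⟩ := exists_extension_of_hasDerivAt (continuousOn_matB hw j m μ lam)
    (S := Ioi T') (z := combineModes u p c) (fun r hr => hpos' r hr) ordConnected_Ioi
    (fun r hr => hasDerivAt_combineModes (fun k => hud k r (hT'.trans (le_of_lt hr)))
      (fun k => hpd k r (hT'.trans (le_of_lt hr))) (fun k => hW0 k r (hT'.trans (le_of_lt hr)))
      (fun k => hcd k r hr))
  refine ⟨y, hy, ?_⟩
  -- The prescribed leading slope omits the term `β u / r` of the true slope; that term is `o(u)`.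
  set b : ℝ → ℂ := fun r => modeSign i * r * u i r with hbd
  have hmax1 : u i =O[atTop] fun r => max ‖u i r‖ ‖b r‖ := by
    refine IsBigO.of_bound 1 (Eventually.of_forall fun r => ?_)
    rw [one_mul, Real.norm_of_nonneg (by positivity)]
    exact le_max_left _ _
  have hmax2 : (fun r : ℝ => (r : ℂ) * u i r) =O[atTop] fun r => max ‖u i r‖ ‖b r‖ := by
    refine IsBigO.of_bound 1 (Eventually.of_forall fun r => ?_)
    rw [one_mul, Real.norm_of_nonneg (by positivity)]
    refine le_of_eq_of_le ?_ (le_max_right _ _)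
    simp only [hbd]
    rcases modeSign_cases i with h | h <;> rw [h] <;> simp
  have hsmall : ∀ k, (fun r => (c k r - if k = i then 1 else 0) * u k r) =o[atTop] u i := by
    intro k
    have h1 : Tendsto (fun r => (c k r - if k = i then 1 else 0) * (‖u k r‖ / ‖u i r‖ : ℝ)) atTop
        (𝓝 0) := by
      by_cases hk : k = i
      · subst hk
        have := (hc k).sub_const 1
        simp only [div_self (hun k _).ne', if_true, sub_self] at this ⊢
        simpa using this
      · simpa [hk] using hc k
    rw [isLittleO_iff]
    intro ε hε
    filter_upwards [(tendsto_zero_iff_norm_tendsto_zero.1 h1).eventually (gt_mem_nhds hε)] with r hr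
    rw [norm_mul, Complex.norm_of_nonneg (by positivity), ← mul_div_assoc, div_lt_iff₀ (hun i r)]
      at hr
    rw [norm_mul]
    exact hr.le
  have hfin : AsympEquiv atTop (combineModes u p c) (fun r => modeVector i (u i r) (b r)) := by
    refine asympEquiv_combineModes i hsmall (fun k => ?_) ?_
    · refine IsLittleO.trans_isBigO ?_ hmax2
      have h1 : (fun r : ℝ => (modeSign k * r + β k * (r : ℂ)⁻¹ : ℂ)) =O[atTop]
          fun r : ℝ => (r : ℂ) := by
        refine IsBigO.of_bound (1 + ‖β k‖) ?_
        filter_upwards [eventually_ge_atTop 1] with r hr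
        have h2 : ‖(modeSign k : ℂ)‖ = 1 := by
          rcases modeSign_cases k with h | h <;> rw [h] <;> norm_num
        refine (norm_add_le _ _).trans ?_
        rw [norm_mul, norm_mul, norm_inv, h2, one_mul, Complex.norm_of_nonneg (by linarith), add_mul,
          one_mul]
        gcongr
        exact (inv_le_one_of_one_le₀ hr).trans hr
      refine (h1.mul_isLittleO (hsmall k)).congr_left fun r => ?_
      simp only [hp, hu, infSlope, hβ]
      ring
    · refine IsLittleO.trans_isBigO ?_ hmax1
      have h1 : (fun r : ℝ => β i * (r : ℂ)⁻¹) =o[atTop] fun _ => (1 : ℂ) := by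
        rw [isLittleO_one_iff]
        have h2 : Tendsto (fun r : ℝ => ((r⁻¹ : ℝ) : ℂ)) atTop (𝓝 ((0 : ℝ) : ℂ)) :=
          (Complex.continuous_ofReal.tendsto 0).comp tendsto_inv_atTop_zero
        simpa using h2.const_mul (β i)
      refine (h1.mul_isBigO (isBigO_refl (u i) atTop)).congr (fun r => ?_) fun r => one_mul _
      simp only [hbd, hp, hu, infSlope, hβ]
      ring
  have hlead : (fun r => modeVector i (u i r) (b r)) =ᶠ[atTop] leadInf μ lam i := by
    filter_upwards [eventually_gt_atTop 0] with r hr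
    exact (leadInf_eq μ lam i hr).symm
  have hev : combineModes u p c =ᶠ[atTop] y := by
    filter_upwards [eventually_gt_atTop T'] with r hr
    exact (hyz hr).symm
  constructor
  · exact hfin.1.congr' (hev.sub hlead) hlead
  · refine hfin.2.congr' ?_ (hlead.fun_comp valuePart)
    filter_upwards [hev, hlead] with r h1 h2
    rw [h1, h2]

/-! ### Linear independence at infinity and conclusion -/

theorem AsympEquiv.of_common {l : Filter ℝ} {f g h : ℝ → Fin 4 → ℂ} (hf : AsympEquiv l f h)
    (hg : AsympEquiv l g h) : AsympEquiv l f g :=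
  ⟨IsEquivalent.trans (v := h) hf.1 (IsEquivalent.symm hg.1),
    IsEquivalent.trans (v := fun r => valuePart (h r)) hf.2
      (IsEquivalent.symm (u := fun r => valuePart (g r)) hg.2)⟩

/-- Slopes exceed values by a factor `r`, so the whole-vector condition controls the values only up
to `o(r u)`. Their limit comes from the separate condition on `valuePart`. -/
theorem AsympEquiv.tendsto_scaled {μ : ℝ} {lam : ℂ} {i : Fin 4} {y : ℝ → Fin 4 → ℂ}
    (h : AsympEquiv atTop y (leadInf μ lam i)) (a : Fin 4) :
    Tendsto (fun r : ℝ => ![1, (r : ℂ)⁻¹, 1, (r : ℂ)⁻¹] a * y r a / infValue μ lam i r) atTop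
      (𝓝 (modeVector i 1 (modeSign i) a)) := by
  have hs : ‖(modeSign i : ℂ)‖ = 1 := by
    rcases modeSign_cases i with h | h <;> rw [h] <;> norm_num
  have hlead : leadInf μ lam i =ᶠ[atTop] fun r =>
      modeVector i (infValue μ lam i r) (modeSign i * r * infValue μ lam i r) := by
    filter_upwards [eventually_gt_atTop 0] with r hr
    exact leadInf_eq μ lam i hr
  have h1 : (fun r => y r - leadInf μ lam i r) =o[atTop] fun r => r * infValue μ lam i r := by
    refine h.1.trans_isBigO (IsBigO.of_bound 1 ?_)
    filter_upwards [hlead, eventually_ge_atTop 1] with r hr hr1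
    have hr0 : ‖(r : ℂ)‖ = r := Complex.norm_of_nonneg (by linarith)
    rw [hr, norm_modeVector_eq, norm_mul, norm_mul, norm_mul, hs, one_mul, one_mul, hr0]
    exact max_le (le_mul_of_one_le_left (norm_nonneg _) hr1) le_rfl
  have h2 : (fun r => valuePart (y r) - valuePart (leadInf μ lam i r)) =o[atTop]
      infValue μ lam i := by
    refine h.2.trans_isBigO (IsBigO.of_bound 1 ?_)
    filter_upwards [hlead] with r hr
    rw [hr, norm_valuePart_modeVector, one_mul]
  have hdiff : Tendsto (fun r : ℝ => ![1, (r : ℂ)⁻¹, 1, (r : ℂ)⁻¹] a *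
      (y r a - leadInf μ lam i r a) / infValue μ lam i r) atTop (𝓝 0) := by
    have hslope : ∀ a, Tendsto (fun r : ℝ => (r : ℂ)⁻¹ * (y r a - leadInf μ lam i r a) /
        infValue μ lam i r) atTop (𝓝 0) := fun a => by
      refine ((isLittleO_pi.1 h1 a).tendsto_div_nhds_zero).congr fun r => ?_
      rw [Pi.sub_apply, div_mul_eq_div_div, inv_mul_eq_div]
    have hvalue := fun a => (isLittleO_pi.1 h2 a).tendsto_div_nhds_zero
    fin_cases a
    · simpa [valuePart] using hvalue 0
    · simpa using hslope 1
    · simpa [valuePart] using hvalue 1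
    · simpa using hslope 3
  have h3 := hdiff.add_const (modeVector i 1 (modeSign i) a)
  rw [zero_add] at h3
  refine h3.congr' ?_
  filter_upwards [hlead, eventually_gt_atTop 0] with r hr hr0
  have hrc : (r : ℂ) ≠ 0 := Complex.ofReal_ne_zero.2 hr0.ne'
  have hu := infValue_ne_zero μ lam i r
  have h4 : modeVector i 1 (modeSign i) a =
      ![1, (r : ℂ)⁻¹, 1, (r : ℂ)⁻¹] a * leadInf μ lam i r a / infValue μ lam i r := by
    rw [hr]
    generalize infValue μ lam i r = v at hu
    clear h hs hlead h1 h2 hdiff h3 hr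
    fin_cases i <;> fin_cases a <;> simp [modeVector, modeSign] <;> field_simp
  rw [h4]
  ring

/-- After scaling slope rows by `1/r` and columns by the mode values, the solution matrix converges
to an invertible constant matrix. Its determinant is therefore nonzero at some `r`, and independence
at one point is enough. -/
theorem linearIndependent_of_asympEquiv_leadInf {μ : ℝ} {lam : ℂ} {y : Fin 4 → ℝ → Fin 4 → ℂ}
    (h : ∀ i, AsympEquiv atTop (y i) (leadInf μ lam i)) :
    LinearIndependent ℂ (fun i => (Ioi (0 : ℝ)).domRestrict (y i)) := by
  set N : ℝ → Matrix (Fin 4) (Fin 4) ℂ := fun r => Matrix.of fun a i =>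
    ![1, (r : ℂ)⁻¹, 1, (r : ℂ)⁻¹] a * y i r a / infValue μ lam i r with hN
  set P : Matrix (Fin 4) (Fin 4) ℂ := Matrix.of fun a i => modeVector i 1 (modeSign i) a with hP
  have hNP : Tendsto N atTop (𝓝 P) :=
    tendsto_pi_nhds.2 fun a => tendsto_pi_nhds.2 fun i => (h i).tendsto_scaled a
  have hdet : Tendsto (fun r => (N r).det) atTop (𝓝 P.det) :=
    (continuous_id.matrix_det.tendsto P).comp hNP
  have hPdet : P.det ≠ 0 := by
    have h1 : !![1/2, 1/2, 0, 0; 0, 0, 1/2, 1/2; 1/2, -1/2, 0, 0; 0, 0, 1/2, -1/2] * P = 1 := by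
      ext a b
      fin_cases a <;> fin_cases b <;>
        simp [hP, Matrix.mul_apply, Fin.sum_univ_four, modeVector, modeSign] <;> norm_num
    exact Matrix.det_ne_zero_of_left_inverse h1
  obtain ⟨r, hr, hr0⟩ := ((hdet.eventually_ne hPdet).and (eventually_gt_atTop 0)).exists
  rw [Fintype.linearIndependent_iff]
  intro c hc
  have h1 : ∀ a, ∑ k, c k * y k r a = 0 := by
    intro a
    have := congrFun (congrFun hc ⟨r, mem_Ioi.2 hr0⟩) a
    simpa [Finset.sum_apply] using this
  have h2 : N r *ᵥ (fun k => c k * infValue μ lam k r) = 0 := by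
    funext a
    have h3 : ∀ k, N r a k * (c k * infValue μ lam k r) =
        ![1, (r : ℂ)⁻¹, 1, (r : ℂ)⁻¹] a * (c k * y k r a) := fun k => by
      have := infValue_ne_zero μ lam k r
      simp only [hN, Matrix.of_apply]
      field_simp
    simp only [Matrix.mulVec, dotProduct, h3, ← Finset.mul_sum, h1, mul_zero, Pi.zero_apply]
  intro k
  have h4 := congrFun (Matrix.eq_zero_of_mulVec_eq_zero hr h2) k
  exact (mul_eq_zero.1 h4).resolve_right (infValue_ne_zero μ lam k r)

theorem IsVortexProfile.exists_sq_le_div {m μ : ℝ} {w : ℝ → ℝ} (hw : IsVortexProfile m μ w) :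
    ∃ C : ℝ, ∀ᶠ r in atTop, w r ^ 2 ≤ C / r := by
  obtain ⟨C, hC⟩ := hw.exists_le_div
  refine ⟨C ^ 2, ?_⟩
  filter_upwards [hC, eventually_ge_atTop 1] with r h1 h2
  have h3 : 0 < r := by linarith
  refine (pow_le_pow_left₀ (hw.nonneg r h3) h1 2).trans ?_
  rw [div_pow]
  exact div_le_div_of_nonneg_left (sq_nonneg C) h3 (le_self_pow₀ h2 two_ne_zero)

theorem matB_zero (j : ℤ) (m μ : ℝ) (lam : ℂ) :
    matB (fun _ => 0) j m μ lam = matBInf j m μ lam := by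
  funext r
  simp [matB, matBW]

theorem theorem5p1 (lam : ℂ) (m μ : ℝ) (hm : 0 < m) (j : ℤ)
    (w : ℝ → ℝ) (hw : IsVortexProfile m μ w) :
    ∃ y0 yInf yModel0 yModelInf : Fin 4 → ℝ → Fin 4 → ℂ,
      -- the model solutions at zero
      (∀ i, IsSolutionOfSystem (matBZero j m) (yModel0 i)) ∧
      LinearIndependent ℂ (fun i => (Ioi (0 : ℝ)).domRestrict (yModel0 i)) ∧
      (∀ i, AsympEquiv (𝓝[>] 0) (yModel0 i) (leadZero j m i)) ∧
      -- the model solutions at infinity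
      (∀ i, IsSolutionOfSystem (matBInf j m μ lam) (yModelInf i)) ∧
      LinearIndependent ℂ (fun i => (Ioi (0 : ℝ)).domRestrict (yModelInf i)) ∧
      (∀ i, AsympEquiv atTop (yModelInf i) (leadInf μ lam i)) ∧
      -- the solutions of the full system
      (∀ i, IsSolutionOfSystem (matB w j m μ lam) (y0 i)) ∧
      (∀ i, AsympEquiv (𝓝[>] 0) (y0 i) (yModel0 i)) ∧
      (∀ i, IsSolutionOfSystem (matB w j m μ lam) (yInf i)) ∧
      (∀ i, AsympEquiv atTop (yInf i) (yModelInf i)) := by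
  choose y0 hy0 hy0' using
    exists_solution_asympEquiv_leadZero lam m μ j hw.continuousOn hw.bounded_zero
  choose yInf hyInf hyInf' using
    exists_solution_asympEquiv_leadInf lam m μ j hw.continuousOn hw.exists_sq_le_div
  -- The model solutions at infinity are those of the full system for `w = 0`. They share the
  -- leading terms of `yInf`, so the two families are equivalent to each other.
  choose yModelInf hyM hyM' using exists_solution_asympEquiv_leadInf lam m μ j
    (IsVortexProfile.zero m μ).continuousOn (IsVortexProfile.zero m μ).exists_sq_le_div
  rw [matB_zero] at hyM
  exact ⟨y0, yInf, leadZero j m, yModelInf, isSolutionOfSystem_leadZero j m,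
    linearIndependent_leadZero j m, fun i => ⟨IsEquivalent.refl, IsEquivalent.refl⟩, hyM,
    linearIndependent_of_asympEquiv_leadInf hyM', hyM', hy0, hy0', hyInf,
    fun i => (hyInf' i).of_common (hyM' i)⟩
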